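/- Let $0<p<1/2$ and let $X_1,X_2,\dots$ be i.i.d. Bernoulli-$p$ bits. Write $H(p)=-p\log_2 p-(1-p)\log_2(1-p)$. An $(R_0,R,n)$ code encodes $X^n$ and a secret key $\omega$, uniform on $\{1,\dots,\lfloor 2^{nR_0}\rfloor\}$ and independent of $X^n$, into a message $I\in\{1,\dots,\lfloor 2^{nR}\rfloor\}$, and decodes $\hat X^n$ from $(I,\omega)$. Encoder and decoder are either both required to be deterministic functions, or allowed to use local randomization; all statements below hold for each of these two classes of codes. The distortion forced by a code on a causal eavesdropper is $$\frac1n\sum_{q=1}^n\ \min_{z}\ \mathbf P\bigl(X_q\neq z(I,X^{q-1})\bigr),$$ the minimum being over all functions $z$ of $(I,X^{q-1})$ with values in $\{0,1\}$. A triple $(R_0,R,D)$ is achievable if there are $(R_0,R,n)$ codes, $n=1,2,\dots$, with $\mathbf P(\hat X^n=X^n)\to1$, each forcing distortion at least $D$; let $\mathcal S$ be the closure of the set of achievable triples, and call the largest $D$ with $(R_0,R,D)\in\mathcal S$ the optimal forced distortion at $(R_0,R)$. Let $R\ge H(p)$. Then: 1. If $0\le R_0<2p$, the optimal forced distortion at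 $(R_0,R)$ is $R_0/2$. 2. If $R_0\ge 2p$, the optimal forced distortion at $(R_0,R)$ is $p$; moreover $2p<H(p)$. Thus the full distortion $p$ is forced with key rate only $2p<H(p)$. 3. Every code of length $n\ge1$ (with at least one key value) that has perfect secrecy, i.e. $I$ independent of $X^n$, forces distortion exactly $p$; and the least $R_0$ such that $(R_0,R)$ is in the closure of the rate pairs allowing codes with perfect secrecy for every $n$ and $\mathbf P(\hat X^n=X^n)\to1$ is $H(p)$. 4. Naively hiding a prefix is strictly suboptimal when $0<R_0<H(p)$: let $\mathcal S_{\mathrm{naive}}$ be defined as $\mathcal S$, but only with sequences of codes for which there are prefix lengths $m_n\le n$ such that $X^{m_n}$ is independent of $I$ (the prefix is perfectly hidden) and, for some functions $r_n$, $\mathbf P\bigl(r_n(I)=(X_{m_n+1},\dots,X_n)\bigr)\to1$ (the rest is revealed). Then the largest $D$ with $(R_0,R,D)\in\mathcal S_{\mathrm{naive}}$ is $pR_0/H(p)$, which is strictly smaller than the optimal forced distortion at $(R_0,R)$. -/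

import Mathlib

open Filter Topology

noncomputable section

namespace PartialSecrecy

/-- The number of elements of `[2^{nR}]`, for block length `n` and rate `R` (bits per symbol). -/
def numValues (n : ℕ) (R : ℝ) : ℕ := ⌊(2 : ℝ) ^ ((n : ℝ) * R)⌋₊

/-- A block code for sequences of length `n` over the alphabet `𝒳`, with `K` values of the secret
key and `M` messages. The encoder gives, for a source sequence and a key, a distribution on
messages; the decoder gives, for a message and a key, a distribution on reconstructions. -/
structure Code (𝒳 : Type) [Fintype 𝒳] (n K M : ℕ) where
  enc : (Fin n → 𝒳) → Fin K → stdSimplex ℝ (Fin M)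
  dec : Fin M → Fin K → stdSimplex ℝ (Fin n → 𝒳)

/-- Whether codes consist of functions, or may use local randomization at both ends. -/
inductive CodeClass
  | deterministic
  | randomized

namespace Code

variable {𝒳 𝒵 : Type} [Fintype 𝒳] {n K M : ℕ}

open Classical in
/-- The code is given by an encoding function `f` and a decoding function `g`. -/
def IsDeterministic (c : Code 𝒳 n K M) : Prop :=
  ∃ (f : (Fin n → 𝒳) → Fin K → Fin M) (g : Fin M → Fin K → (Fin n → 𝒳)),
    (∀ x ω i, (c.enc x ω).1 i = if f x ω = i then 1 else 0) ∧
    (∀ i ω x, (c.dec i ω).1 x = if g i ω = x then 1 else 0)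

/-- Membership of a code in the given class. -/
def InClass (c : Code 𝒳 n K M) : CodeClass → Prop
  | .deterministic => c.IsDeterministic
  | .randomized => True

/-- `P (X^n = x, I = i)`, when `X^n` is i.i.d. with mass function `p₀`, the key is uniform on
`[K]` and independent of `X^n`, and `I` is the transmitted message. -/
def jointProb (c : Code 𝒳 n K M) (p₀ : 𝒳 → ℝ) (x : Fin n → 𝒳) (i : Fin M) : ℝ :=
  (∏ j, p₀ (x j)) * ∑ ω : Fin K, (K : ℝ)⁻¹ * (c.enc x ω).1 i

open Classical in
/-- `P (A (X^n, I))` for an event `A` about the source sequence and the message. -/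
def prob (c : Code 𝒳 n K M) (p₀ : 𝒳 → ℝ) (A : (Fin n → 𝒳) → Fin M → Prop) : ℝ :=
  ∑ x, ∑ i, if A x i then c.jointProb p₀ x i else 0

/-- `P (X̂^n = X^n)`. -/
def successProb (c : Code 𝒳 n K M) (p₀ : 𝒳 → ℝ) : ℝ :=
  ∑ x : Fin n → 𝒳, ∑ ω : Fin K, ∑ i : Fin M,
    (∏ j, p₀ (x j)) * (K : ℝ)⁻¹ * (c.enc x ω).1 i * (c.dec i ω).1 x

/-- The symbols `x^{q-1}` that precede position `q`. -/
def past (x : Fin n → 𝒳) (q : Fin n) : Fin q.val → 𝒳 :=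
  fun j => x (Fin.castLE q.isLt.le j)

/-- `E d(X_q, z(I, X^{q-1}))`. -/
def expectedDistortion (c : Code 𝒳 n K M) (p₀ : 𝒳 → ℝ) (d : 𝒳 → 𝒵 → ℝ) (q : Fin n)
    (z : Fin M → (Fin q.val → 𝒳) → 𝒵) : ℝ :=
  ∑ x, ∑ i, c.jointProb p₀ x i * d (x q) (z i (past x q))

/-- `(1/n) ∑_q min_z E d(X_q, z(I, X^{q-1}))`: the distortion that the code forces on a causal
eavesdropper. (For a finite nonempty reconstruction alphabet the infimum is a minimum.) -/
def forcedDistortion (c : Code 𝒳 n K M) (p₀ : 𝒳 → ℝ) (d : 𝒳 → 𝒵 → ℝ) : ℝ :=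
  (n : ℝ)⁻¹ * ∑ q : Fin n,
    ⨅ z : Fin M → (Fin q.val → 𝒳) → 𝒵, c.expectedDistortion p₀ d q z

/-- The first `m` source symbols are perfectly hidden: they are independent of the message. -/
def HidesPrefix (c : Code 𝒳 n K M) (p₀ : 𝒳 → ℝ) (m : ℕ) : Prop :=
  ∀ (u : Fin n → 𝒳) (i : Fin M),
    c.prob p₀ (fun x i' => (∀ j : Fin n, j.val < m → x j = u j) ∧ i' = i) =
      c.prob p₀ (fun x _ => ∀ j : Fin n, j.val < m → x j = u j) *
        c.prob p₀ (fun _ i' => i' = i)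

/-- Perfect secrecy: the whole source sequence is independent of the message. -/
def PerfectlySecret (c : Code 𝒳 n K M) (p₀ : 𝒳 → ℝ) : Prop := c.HidesPrefix p₀ n

/-- The probability that the estimate `r(I)`, formed without the key, is right about all source
symbols after the first `m`. -/
def revealProb (c : Code 𝒳 n K M) (p₀ : 𝒳 → ℝ) (m : ℕ) (r : Fin M → Fin n → 𝒳) : ℝ :=
  c.prob p₀ (fun x i => ∀ j : Fin n, m ≤ j.val → r i j = x j)

end Code

section Regions

variable {𝒳 𝒵 : Type} [Fintype 𝒳]

/-- The rate pair `(R₀, R)` can force distortion `D`: there are `(R₀, R, n)` codes for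
`n = 1, 2, …` with asymptotically lossless transmission and forced distortion at least `D`. -/
def CanForce (k : CodeClass) (p₀ : 𝒳 → ℝ) (d : 𝒳 → 𝒵 → ℝ) (R₀ R D : ℝ) : Prop :=
  ∃ c : ∀ n : ℕ, Code 𝒳 n (numValues n R₀) (numValues n R),
    (∀ n, (c n).InClass k) ∧
    Tendsto (fun n => (c n).successProb p₀) atTop (𝓝 1) ∧
    ∀ n, 1 ≤ n → D ≤ (c n).forcedDistortion p₀ d

/-- The secrecy rate-distortion region: the closure of the achievable triples `(R₀, R, D)`. -/
def secrecyRegion (k : CodeClass) (p₀ : 𝒳 → ℝ) (d : 𝒳 → 𝒵 → ℝ) : Set (ℝ × ℝ × ℝ) :=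
  closure {t | CanForce k p₀ d t.1 t.2.1 t.2.2}

/-- As `CanForce`, but by naive use of the key: a prefix of the sequence (of length `m n`) is
perfectly hidden, and the rest is revealed to everyone, with probability tending to one. -/
def CanForceNaively (k : CodeClass) (p₀ : 𝒳 → ℝ) (d : 𝒳 → 𝒵 → ℝ) (R₀ R D : ℝ) : Prop :=
  ∃ (c : ∀ n : ℕ, Code 𝒳 n (numValues n R₀) (numValues n R)) (m : ℕ → ℕ)
    (r : ∀ n : ℕ, Fin (numValues n R) → Fin n → 𝒳),
    (∀ n, (c n).InClass k) ∧
    (∀ n, m n ≤ n) ∧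
    (∀ n, (c n).HidesPrefix p₀ (m n)) ∧
    Tendsto (fun n => (c n).revealProb p₀ (m n) (r n)) atTop (𝓝 1) ∧
    Tendsto (fun n => (c n).successProb p₀) atTop (𝓝 1) ∧
    ∀ n, 1 ≤ n → D ≤ (c n).forcedDistortion p₀ d

/-- The closure of the triples `(R₀, R, D)` achievable by naive prefix hiding. -/
def naiveRegion (k : CodeClass) (p₀ : 𝒳 → ℝ) (d : 𝒳 → 𝒵 → ℝ) : Set (ℝ × ℝ × ℝ) :=
  closure {t | CanForceNaively k p₀ d t.1 t.2.1 t.2.2}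

/-- The closure of the rate pairs `(R₀, R)` at which asymptotically lossless transmission with
perfect secrecy is possible. -/
def perfectSecrecyRegion (k : CodeClass) (p₀ : 𝒳 → ℝ) : Set (ℝ × ℝ) :=
  closure {t | ∃ c : ∀ n : ℕ, Code 𝒳 n (numValues n t.1) (numValues n t.2),
    (∀ n, (c n).InClass k) ∧
    (∀ n, (c n).PerfectlySecret p₀) ∧
    Tendsto (fun n => (c n).successProb p₀) atTop (𝓝 1)}

end Regions

/-- The Bernoulli-`p` mass function on bits. -/
def bernoulli (p : ℝ) : Bool → ℝ := fun b => if b then p else 1 - p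

/-- Hamming distortion on bits. -/
def hamming : Bool → Bool → ℝ := fun x z => if x = z then 0 else 1

/-- The binary entropy function, in bits. -/
def binaryEntropy (p : ℝ) : ℝ := Real.binEntropy p / Real.log 2

end PartialSecrecy

end

open Filter Topology

noncomputable section

/-! Upper bound. For each key value the holder of the message can name the most likely source
sequence. This gives a list of at most K candidates, K being the number of keys, which contains the
truth up to the probability of a decoding error (`Code.exists_candidates`). Predict each bit by
weighted majority among the candidates that agree with the past. If the two values of the next bit
have weights m₀, m₁ and are shared by c₀, c₁ candidates, the predictor errs with weight min(m₀, m₁),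
while the logarithm of the number of surviving candidates drops by at least min(m₀, m₁) log 4 in
weighted sum, because 4c₀c₁ ≤ (c₀ + c₁)² (`min_mul_log_four_le`). The drops telescope to at most log
K, so about nR₀/2 mistakes are made in all (`Code.forcedDistortion_le_log`). The constant guess 0
errs at rate p. Hence the bound min(R₀/2, p).

Construction. Take l ≈ an with a below min(R₀/2, p). Cover the typical sequences by cubes, in which
2l positions are free and the others are fixed. A cube is tuned to sequences having l ones among the
free positions, so it captures about 4^l of the roughly exp(n h(p)) typical sequences, where h is
entropy in nats; a greedy choice then needs only about exp(n h(p)) / 4^l cubes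
(`exists_cover_slice`, `exists_cover_typical`). Send the cube in the clear and the position in the
cube under a one-time pad: the message rate is H(p) and the key rate 2a. In a cube, a causal
predictor's mistakes at the free positions determine the sequence (`Code.injOn_mistakes`), so at
most (2l choose k) sequences give k mistakes. As each sequence carries nearly the same small weight,
a Chernoff bound shows that few of them are predicted with fewer than (1 - 2η)l mistakes
(`Code.exists_cube_code`).

Perfect secrecy and naive hiding. If a prefix of length m is independent of the message, the list
still meets it in at most K prefixes, whose probability is small unless log K is nearly m h(p)
(`Code.HidesPrefix.successProb_le`). So m/n is at most about R₀/H(p), the revealed suffix costs the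
eavesdropper nothing, and one-time padding a prefix attains the bound. The comparison rests on 2p <
H(p), by strict concavity of entropy. -/

namespace PartialSecrecy

set_option linter.unusedSectionVars false

/-! ### I.i.d. bits and typical sequences -/

section

variable {ι : Type*} [Fintype ι] [DecidableEq ι]

/-- The probability of a sequence of i.i.d. Bernoulli-`p` bits. -/
def seqProb (p : ℝ) (x : ι → Bool) : ℝ := ∏ j, bernoulli p (x j)

/-- The positions of the ones of a bit sequence. -/
def ones (x : ι → Bool) : Finset ι := Finset.univ.filter fun j => x j = true

open Classical in
/-- The sequences whose number of ones is within `a` of its mean. -/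
def typical (ι : Type*) [Fintype ι] [DecidableEq ι] (p a : ℝ) : Finset (ι → Bool) :=
  Finset.univ.filter fun x => |((ones x).card : ℝ) - Fintype.card ι * p| ≤ a

/-- The log-likelihood ratio `log ((1 - p) / p)`. -/
def logRatio (p : ℝ) : ℝ := Real.log (1 - p) - Real.log p

theorem bernoulli_pos {p : ℝ} (hp0 : 0 < p) (hp : p < 1 / 2) (b : Bool) : 0 < bernoulli p b := by
  cases b <;> simp [bernoulli] <;> linarith

theorem sum_bernoulli (p : ℝ) : ∑ b, bernoulli p b = 1 := by
  simp [bernoulli]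

theorem le_bernoulli {p : ℝ} (hp : p < 1 / 2) (b : Bool) : p ≤ bernoulli p b := by
  cases b <;> simp [bernoulli]; linarith

theorem logRatio_pos {p : ℝ} (hp0 : 0 < p) (hp : p < 1 / 2) : 0 < logRatio p :=
  sub_pos.2 (Real.log_lt_log hp0 (by linarith))

theorem seqProb_pos {p : ℝ} (hp0 : 0 < p) (hp : p < 1 / 2) (x : ι → Bool) : 0 < seqProb p x :=
  Finset.prod_pos fun _ _ => bernoulli_pos hp0 hp _

theorem sum_prod_apply (f : ι → Bool → ℝ) :
    ∑ x : ι → Bool, ∏ j, f j (x j) = ∏ j, ∑ b, f j b := by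
  rw [Finset.prod_univ_sum, Fintype.piFinset_univ]

theorem sum_seqProb (p : ℝ) : ∑ x : ι → Bool, seqProb p x = 1 := by
  simp only [seqProb]
  rw [sum_prod_apply fun _ b => bernoulli p b]
  simp only [sum_bernoulli, Finset.prod_const_one]

theorem sum_seqProb_mul_mul (p : ℝ) (f g : Bool → ℝ) (i j : ι) :
    ∑ x : ι → Bool, seqProb p x * (f (x i) * g (x j)) =
      ∏ k, ∑ b, bernoulli p b * ((if k = i then f b else 1) * (if k = j then g b else 1)) := by
  rw [← sum_prod_apply fun k b =>
    bernoulli p b * ((if k = i then f b else 1) * (if k = j then g b else 1))]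
  refine Finset.sum_congr rfl fun x _ => ?_
  rw [Finset.prod_mul_distrib, Finset.prod_mul_distrib]
  simp [seqProb]

theorem sum_seqProb_mul_apply (p : ℝ) (f : Bool → ℝ) (i : ι) :
    ∑ x : ι → Bool, seqProb p x * f (x i) = ∑ b, bernoulli p b * f b := by
  have h := sum_seqProb_mul_mul p f (fun _ => 1) i i
  simp only [mul_one, ite_self] at h
  rw [h, Finset.prod_eq_single i]
  · simp
  · intro k _ hk
    simp only [hk, if_false, mul_one, sum_bernoulli]
  · simp

/-- The variance of the number of ones. Cross terms vanish because the centred bit has mean zero,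
and each diagonal term is p(1 - p) ≤ 1. -/
theorem sum_seqProb_sq_le {p : ℝ} (hp0 : 0 < p) (hp : p < 1 / 2) :
    ∑ x : ι → Bool, seqProb p x * (((ones x).card : ℝ) - Fintype.card ι * p) ^ 2 ≤
      Fintype.card ι := by
  set g : Bool → ℝ := fun b => (if b then 1 else 0) - p with hg
  have h1 : ∀ x : ι → Bool, ((ones x).card : ℝ) - Fintype.card ι * p = ∑ j, g (x j) := by
    intro x
    simp [hg, ones, Finset.sum_sub_distrib, Finset.card_univ]
  have h2 : ∀ x : ι → Bool, seqProb p x * (((ones x).card : ℝ) - Fintype.card ι * p) ^ 2 =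
      ∑ i, ∑ j, seqProb p x * (g (x i) * g (x j)) := by
    intro x
    rw [h1, sq, Finset.sum_mul_sum, Finset.mul_sum]
    exact Finset.sum_congr rfl fun i _ => Finset.mul_sum _ _ _
  simp only [h2]
  rw [Finset.sum_comm]
  have h3 : ∀ i : ι, ∑ x : ι → Bool, ∑ j, seqProb p x * (g (x i) * g (x j)) ≤ 1 := by
    intro i
    rw [Finset.sum_comm, Finset.sum_eq_single i]
    · rw [sum_seqProb_mul_apply p (fun b => g b * g b) i]
      simp only [Fintype.sum_bool, hg, bernoulli, if_true]
      simp
      nlinarith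
    · intro j _ hj
      rw [sum_seqProb_mul_mul]
      apply Finset.prod_eq_zero (Finset.mem_univ i)
      simp [hj.symm, hg, bernoulli]
      ring
    · simp
  calc _ ≤ ∑ i : ι, (1 : ℝ) := Finset.sum_le_sum fun i _ => h3 i
    _ = Fintype.card ι := by simp

/-- Chebyshev's inequality with the variance bound `sum_seqProb_sq_le`. -/
theorem le_sum_typical {p a : ℝ} (hp0 : 0 < p) (hp : p < 1 / 2) (ha : 0 < a) :
    1 - Fintype.card ι / a ^ 2 ≤ ∑ x ∈ typical ι p a, seqProb p x := by
  have h1 := Finset.sum_add_sum_compl (typical ι p a) (seqProb p)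
  rw [sum_seqProb] at h1
  have h2 : (∑ x ∈ (typical ι p a)ᶜ, seqProb p x) * a ^ 2 ≤ Fintype.card ι := by
    refine le_trans ?_ (sum_seqProb_sq_le (ι := ι) hp0 hp)
    rw [Finset.sum_mul]
    refine le_trans (Finset.sum_le_sum fun x hx => ?_)
      (Finset.sum_le_univ_sum_of_nonneg fun x =>
        mul_nonneg (seqProb_pos hp0 hp x).le (sq_nonneg _))
    refine mul_le_mul_of_nonneg_left ?_ (seqProb_pos hp0 hp x).le
    simp only [typical, Finset.compl_filter, Finset.mem_filter, Finset.mem_univ, true_and,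
      not_le] at hx
    rw [← sq_abs (((ones x).card : ℝ) - _)]
    exact pow_le_pow_left₀ ha.le hx.le 2
  have h3 := (le_div_iff₀ (by positivity : 0 < a ^ 2)).2 h2
  linarith

/-- The log-likelihood is affine in the number of ones, with slope `-logRatio p`; at the mean number
of ones it equals minus the entropy of the sequence. -/
theorem seqProb_eq_exp {p : ℝ} (hp0 : 0 < p) (hp : p < 1 / 2) (x : ι → Bool) :
    seqProb p x = Real.exp (-(Fintype.card ι * Real.binEntropy p) -
      (((ones x).card : ℝ) - Fintype.card ι * p) * logRatio p) := by
  have h1 : seqProb p x = Real.exp (∑ j, Real.log (bernoulli p (x j))) := by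
    rw [Real.exp_sum]
    exact Finset.prod_congr rfl fun j _ => (Real.exp_log (bernoulli_pos hp0 hp _)).symm
  have h2 : ∀ b, Real.log (bernoulli p b) =
      Real.log (1 - p) - (if b then 1 else 0) * logRatio p := by
    intro b
    cases b <;> simp [bernoulli, logRatio]
  rw [h1]
  congr 1
  simp only [h2, Finset.sum_sub_distrib, ← Finset.sum_mul]
  simp only [Finset.sum_const, Finset.card_univ, nsmul_eq_mul, Finset.sum_boole, ones,
    Real.binEntropy_eq_negMulLog_add_negMulLog_one_sub, Real.negMulLog, logRatio]
  ring

theorem seqProb_le_of_mem_typical {p a : ℝ} (hp0 : 0 < p) (hp : p < 1 / 2) {x : ι → Bool}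
    (hx : x ∈ typical ι p a) :
    seqProb p x ≤ Real.exp (-(Fintype.card ι * Real.binEntropy p) + a * logRatio p) := by
  rw [seqProb_eq_exp hp0 hp, Real.exp_le_exp]
  simp only [typical, Finset.mem_filter, Finset.mem_univ, true_and] at hx
  nlinarith [logRatio_pos hp0 hp, (abs_le.1 hx).1]

theorem le_seqProb_of_mem_typical {p a : ℝ} (hp0 : 0 < p) (hp : p < 1 / 2) {x : ι → Bool}
    (hx : x ∈ typical ι p a) :
    Real.exp (-(Fintype.card ι * Real.binEntropy p) - a * logRatio p) ≤ seqProb p x := by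
  rw [seqProb_eq_exp hp0 hp, Real.exp_le_exp]
  simp only [typical, Finset.mem_filter, Finset.mem_univ, true_and] at hx
  nlinarith [logRatio_pos hp0 hp, (abs_le.1 hx).2]

/-- Each typical sequence has at least a fixed probability, and probabilities sum to at most one. -/
theorem card_le_exp_of_subset_typical {p a : ℝ} (hp0 : 0 < p) (hp : p < 1 / 2)
    {s : Finset (ι → Bool)} (hs : s ⊆ typical ι p a) :
    (s.card : ℝ) ≤ Real.exp (Fintype.card ι * Real.binEntropy p + a * logRatio p) := by
  have h1 : (s.card : ℝ) *
      Real.exp (-(Fintype.card ι * Real.binEntropy p) - a * logRatio p) ≤ 1 := by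
    rw [← sum_seqProb (ι := ι) p, ← nsmul_eq_mul]
    exact (Finset.card_nsmul_le_sum _ _ _ fun x hx =>
      le_seqProb_of_mem_typical hp0 hp (hs hx)).trans
      (Finset.sum_le_univ_sum_of_nonneg fun x => (seqProb_pos hp0 hp x).le)
  rw [show -(Fintype.card ι * Real.binEntropy p) - a * logRatio p =
    -(Fintype.card ι * Real.binEntropy p + a * logRatio p) by ring, Real.exp_neg,
    ← div_eq_mul_inv, div_le_one (Real.exp_pos _)] at h1
  exact h1

/-- Strict concavity puts the entropy above its chord from 0 to 1/2, where it takes the values 0 and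
log 2. -/
theorem two_mul_lt_binaryEntropy {p : ℝ} (hp0 : 0 < p) (hp : p < 1 / 2) :
    2 * p < binaryEntropy p := by
  have hlog : 0 < Real.log 2 := Real.log_pos (by norm_num)
  rw [binaryEntropy, lt_div_iff₀ hlog]
  have h := Real.strictConcave_binEntropy.2 (by constructor <;> norm_num : (0 : ℝ) ∈ Set.Icc 0 1)
    (by constructor <;> norm_num : (2⁻¹ : ℝ) ∈ Set.Icc 0 1) (by norm_num)
    (by linarith : 0 < 1 - 2 * p) (by linarith : 0 < 2 * p) (by ring)
  simp only [smul_eq_mul, Real.binEntropy_zero, Real.binEntropy_two_inv] at h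
  have h2 : (1 - 2 * p) * 0 + 2 * p * 2⁻¹ = p := by ring
  rw [h2] at h
  linarith

end

/-! ### Causal prediction and perfectly hidden prefixes -/

theorem seqProb_update {n : ℕ} (p : ℝ) (x : Fin n → Bool) (q : Fin n) (b : Bool) :
    seqProb p (Function.update x q b) =
      bernoulli p b * ∏ j ∈ Finset.univ.erase q, bernoulli p (x j) := by
  rw [seqProb, ← Finset.mul_prod_erase _ _ (Finset.mem_univ q), Function.update_self]
  congr 1
  refine Finset.prod_congr rfl fun j hj => ?_
  rw [Function.update_of_ne (Finset.ne_of_mem_erase hj)]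

namespace Code

variable {n K M : ℕ}

theorem past_update (x : Fin n → Bool) (q : Fin n) (b : Bool) :
    past (Function.update x q b) q = past x q := by
  funext j
  refine Function.update_of_ne (fun h => ?_) _ _
  have := congrArg Fin.val h
  simp at this
  omega

/-- No causal predictor of an i.i.d. Bernoulli-`p` sequence errs with probability below `p`. -/
theorem le_sum_seqProb_mul_hamming {p : ℝ} (hp0 : 0 < p) (hp : p < 1 / 2) (q : Fin n)
    (z : (Fin q.val → Bool) → Bool) :
    p ≤ ∑ x : Fin n → Bool, seqProb p x * hamming (x q) (z (past x q)) := by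
  -- Pair each sequence with the one that differs from it at `q` only. Both have the same past, so
  -- the predictor errs on exactly one of them, and each carries at least the fraction `p` of the
  -- pair's weight.
  let flip : (Fin n → Bool) → (Fin n → Bool) := fun x => Function.update x q (!x q)
  have hflip : Function.Involutive flip := by
    intro x
    simp [flip]
  have h1 : ∀ f : (Fin n → Bool) → ℝ, ∑ x, f (flip x) = ∑ x, f x := fun f =>
    Equiv.sum_comp hflip.toPerm f
  have h2 : ∀ x : Fin n → Bool, p * (seqProb p x + seqProb p (flip x)) ≤
      seqProb p x * hamming (x q) (z (past x q)) +
        seqProb p (flip x) * hamming (flip x q) (z (past (flip x) q)) := by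
    intro x
    have hx : seqProb p x = bernoulli p (x q) * ∏ j ∈ Finset.univ.erase q, bernoulli p (x j) := by
      rw [← seqProb_update, Function.update_eq_self]
    have hr : 0 ≤ ∏ j ∈ Finset.univ.erase q, bernoulli p (x j) :=
      Finset.prod_nonneg fun j _ => (bernoulli_pos hp0 hp _).le
    have hy := seqProb_update p x q (!x q)
    have hs := sum_bernoulli p
    rw [Fintype.sum_bool] at hs
    simp only [flip]
    rw [hx, hy, past_update, Function.update_self]
    have ht := le_bernoulli hp true
    have hf := le_bernoulli hp false
    generalize ∏ j ∈ Finset.univ.erase q, bernoulli p (x j) = r at *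
    generalize z (past x q) = b
    have e1 : p * (bernoulli p true * r + bernoulli p false * r) = p * r := by
      rw [← add_mul, hs, one_mul]
    have e2 := mul_le_mul_of_nonneg_right ht hr
    have e3 := mul_le_mul_of_nonneg_right hf hr
    cases x q <;> cases b <;> simp [hamming] <;> linarith
  have h3 := Finset.sum_le_sum fun x (_ : x ∈ Finset.univ) => h2 x
  rw [← Finset.mul_sum, Finset.sum_add_distrib, Finset.sum_add_distrib, h1 (seqProb p),
    h1 fun x => seqProb p x * hamming (x q) (z (past x q)), sum_seqProb] at h3
  linarith

variable (c : Code Bool n K M)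

theorem jointProb_nonneg {p : ℝ} (hp0 : 0 < p) (hp : p < 1 / 2) (x : Fin n → Bool) (i : Fin M) :
    0 ≤ c.jointProb (bernoulli p) x i :=
  mul_nonneg (seqProb_pos hp0 hp x).le
    (Finset.sum_nonneg fun ω _ => mul_nonneg (by positivity) ((c.enc x ω).2.1 i))

theorem sum_jointProb (hK : 1 ≤ K) (p : ℝ) (x : Fin n → Bool) :
    ∑ i, c.jointProb (bernoulli p) x i = seqProb p x := by
  have hK' : (K : ℝ) ≠ 0 := by positivity
  simp only [jointProb]
  rw [← Finset.mul_sum, Finset.sum_comm]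
  simp only [← Finset.mul_sum, (c.enc x _).2.2]
  simp [seqProb, hK']

theorem sum_sum_jointProb (hK : 1 ≤ K) (p : ℝ) :
    ∑ i, ∑ x, c.jointProb (bernoulli p) x i = 1 := by
  rw [Finset.sum_comm]
  simp only [c.sum_jointProb hK, sum_seqProb]

theorem hamming_nonneg (a b : Bool) : 0 ≤ hamming a b := by
  unfold hamming; split_ifs <;> norm_num

theorem hamming_le_one (a b : Bool) : hamming a b ≤ 1 := by
  unfold hamming; split_ifs <;> norm_num

theorem expectedDistortion_nonneg {p : ℝ} (hp0 : 0 < p) (hp : p < 1 / 2) (q : Fin n)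
    (z : Fin M → (Fin q.val → Bool) → Bool) :
    0 ≤ c.expectedDistortion (bernoulli p) hamming q z :=
  Finset.sum_nonneg fun x _ => Finset.sum_nonneg fun i _ =>
    mul_nonneg (c.jointProb_nonneg hp0 hp x i) (hamming_nonneg _ _)

theorem forcedDistortion_le (p : ℝ)
    (z : ∀ q : Fin n, Fin M → (Fin q.val → Bool) → Bool) :
    c.forcedDistortion (bernoulli p) hamming ≤
      (n : ℝ)⁻¹ * ∑ q, c.expectedDistortion (bernoulli p) hamming q (z q) :=
  mul_le_mul_of_nonneg_left (Finset.sum_le_sum fun q _ =>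
    ciInf_le (Set.finite_range _).bddBelow (z q)) (by positivity)

theorem exists_forcedDistortion_eq (p : ℝ) :
    ∃ z : ∀ q : Fin n, Fin M → (Fin q.val → Bool) → Bool,
      c.forcedDistortion (bernoulli p) hamming =
        (n : ℝ)⁻¹ * ∑ q, c.expectedDistortion (bernoulli p) hamming q (z q) := by
  have h := fun q : Fin n => exists_eq_ciInf_of_finite
    (f := fun z : Fin M → (Fin q.val → Bool) → Bool =>
      c.expectedDistortion (bernoulli p) hamming q z)
  choose z hz using h
  exact ⟨z, by simp only [forcedDistortion, hz]⟩

theorem expectedDistortion_const_false (hK : 1 ≤ K) (p : ℝ) (q : Fin n) :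
    c.expectedDistortion (bernoulli p) hamming q (fun _ _ => false) = p := by
  simp only [expectedDistortion, ← Finset.sum_mul, c.sum_jointProb hK]
  rw [sum_seqProb_mul_apply p (fun b => hamming b false) q]
  simp [bernoulli, hamming]

theorem forcedDistortion_le_self (hK : 1 ≤ K) {p : ℝ} (hp0 : 0 < p) :
    c.forcedDistortion (bernoulli p) hamming ≤ p := by
  refine (c.forcedDistortion_le p fun q _ _ => false).trans ?_
  simp only [c.expectedDistortion_const_false hK]
  rcases Nat.eq_zero_or_pos n with rfl | hn
  · simp [hp0.le]
  · have : (n : ℝ) ≠ 0 := by positivity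
    simp [this]

theorem prob_and_eq (p : ℝ) (A : (Fin n → Bool) → Prop) [DecidablePred A] (i : Fin M) :
    c.prob (bernoulli p) (fun x i' => A x ∧ i' = i) =
      ∑ x, if A x then c.jointProb (bernoulli p) x i else 0 := by
  classical
  unfold prob
  refine Finset.sum_congr rfl fun x _ => ?_
  by_cases h : A x <;> simp [h]

theorem prob_fst (hK : 1 ≤ K) (p : ℝ) (A : (Fin n → Bool) → Prop) [DecidablePred A] :
    c.prob (bernoulli p) (fun x _ => A x) = ∑ x, if A x then seqProb p x else 0 := by
  classical
  unfold prob
  refine Finset.sum_congr rfl fun x _ => ?_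
  by_cases h : A x <;> simp [h, c.sum_jointProb hK]

theorem prob_snd_eq (p : ℝ) (i : Fin M) :
    c.prob (bernoulli p) (fun _ i' => i' = i) = ∑ x, c.jointProb (bernoulli p) x i := by
  classical
  unfold prob
  refine Finset.sum_congr rfl fun x _ => ?_
  rw [Finset.sum_eq_single i] <;> simp +contextual

/-- Sequences that vanish from position `m` on represent the prefixes. Summing over them passes from
independence of prefix events, as in `HidesPrefix`, to functions of the prefix. -/
theorem exists_sum_eq_sum_agree (m : ℕ) :
    ∃ R : Finset (Fin n → Bool), ∀ f : (Fin n → Bool) → ℝ,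
      ∑ x, f x = ∑ u ∈ R, ∑ x, if ∀ j : Fin n, j.val < m → x j = u j then f x else 0 := by
  let t : (Fin n → Bool) → (Fin n → Bool) := fun x j => if j.val < m then x j else false
  refine ⟨Finset.univ.image t, fun f => ?_⟩
  rw [← Finset.sum_fiberwise_of_maps_to (t := Finset.univ.image t) (g := t)
    fun x _ => Finset.mem_image_of_mem t (Finset.mem_univ x)]
  refine Finset.sum_congr rfl fun u hu => ?_
  obtain ⟨y, -, rfl⟩ := Finset.mem_image.1 hu
  rw [Finset.sum_filter]
  refine Finset.sum_congr rfl fun x _ => ?_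
  congr 1
  simp only [t, funext_iff, eq_iff_iff]
  refine forall_congr' fun j => ?_
  by_cases hj : j.val < m <;> simp [hj]

/-- A perfectly hidden prefix is independent of the message, for functions of the prefix. -/
theorem HidesPrefix.sum_mul {c : Code Bool n K M} {p : ℝ} {m : ℕ} (hK : 1 ≤ K)
    (h : c.HidesPrefix (bernoulli p) m) (F : (Fin n → Bool) → ℝ)
    (hF : ∀ x y : Fin n → Bool, (∀ j : Fin n, j.val < m → x j = y j) → F x = F y) (i : Fin M) :
    ∑ x, c.jointProb (bernoulli p) x i * F x =
      (∑ x, c.jointProb (bernoulli p) x i) * ∑ x, seqProb p x * F x := by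
  obtain ⟨R, hR⟩ := exists_sum_eq_sum_agree (n := n) m
  rw [hR fun x => c.jointProb (bernoulli p) x i * F x, hR fun x => seqProb p x * F x,
    Finset.mul_sum]
  refine Finset.sum_congr rfl fun u _ => ?_
  have h1 : ∀ g : (Fin n → Bool) → ℝ,
      (∑ x, if ∀ j : Fin n, j.val < m → x j = u j then g x * F x else 0) =
        (∑ x, if ∀ j : Fin n, j.val < m → x j = u j then g x else 0) * F u := by
    intro g
    rw [Finset.sum_mul]
    refine Finset.sum_congr rfl fun x _ => ?_
    split_ifs with hx
    · rw [hF x u hx]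
    · simp
  rw [h1, h1, ← prob_and_eq, ← prob_fst c hK, ← prob_snd_eq, h u i]
  ring

/-- Given the message, the hidden prefix is still i.i.d.; inside it the eavesdropper is in the
situation of `le_sum_seqProb_mul_hamming`. -/
theorem HidesPrefix.le_expectedDistortion {c : Code Bool n K M} {p : ℝ} {m : ℕ} (hp0 : 0 < p)
    (hp : p < 1 / 2) (hK : 1 ≤ K) (h : c.HidesPrefix (bernoulli p) m) (q : Fin n)
    (hq : q.val < m) (z : Fin M → (Fin q.val → Bool) → Bool) :
    p ≤ c.expectedDistortion (bernoulli p) hamming q z := by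
  rw [expectedDistortion, Finset.sum_comm]
  have h1 : ∀ i, (∑ x, c.jointProb (bernoulli p) x i) * p ≤
      ∑ x, c.jointProb (bernoulli p) x i * hamming (x q) (z i (past x q)) := by
    intro i
    rw [h.sum_mul hK (fun x => hamming (x q) (z i (past x q)))]
    · exact mul_le_mul_of_nonneg_left (le_sum_seqProb_mul_hamming hp0 hp q (z i))
        (Finset.sum_nonneg fun x _ => c.jointProb_nonneg hp0 hp x i)
    · intro x y hxy
      have : past x q = past y q := funext fun j => hxy _ (by simp; omega)
      rw [this, hxy q hq]
  refine le_trans (le_of_eq ?_) (Finset.sum_le_sum fun i _ => h1 i)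
  rw [← Finset.sum_mul, c.sum_sum_jointProb hK, one_mul]

theorem HidesPrefix.le_forcedDistortion {c : Code Bool n K M} {p : ℝ} {m : ℕ} (hp0 : 0 < p)
    (hp : p < 1 / 2) (hK : 1 ≤ K) (h : c.HidesPrefix (bernoulli p) m) (hm : m ≤ n) :
    (m : ℝ) / n * p ≤ c.forcedDistortion (bernoulli p) hamming := by
  obtain ⟨z, hz⟩ := c.exists_forcedDistortion_eq p
  rw [hz, div_eq_inv_mul, mul_assoc]
  refine mul_le_mul_of_nonneg_left ?_ (by positivity)
  have h1 : ∀ q : Fin n, (if q.val < m then p else 0) ≤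
      c.expectedDistortion (bernoulli p) hamming q (z q) := by
    intro q
    split_ifs with hq
    · exact h.le_expectedDistortion hp0 hp hK q hq _
    · exact c.expectedDistortion_nonneg hp0 hp q _
  refine le_trans (le_of_eq ?_) (Finset.sum_le_sum fun q _ => h1 q)
  rw [← Finset.sum_filter, Finset.sum_const, nsmul_eq_mul, Fin.card_filter_val_lt, min_eq_right hm]

/-- Perfect secrecy forces distortion `p`. -/
theorem PerfectlySecret.forcedDistortion_eq {c : Code Bool n K M} {p : ℝ} (hp0 : 0 < p)
    (hp : p < 1 / 2) (hK : 1 ≤ K) (h : c.PerfectlySecret (bernoulli p)) (hn : 1 ≤ n) :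
    c.forcedDistortion (bernoulli p) hamming = p := by
  refine le_antisymm (c.forcedDistortion_le_self hK hp0) ?_
  have h1 := HidesPrefix.le_forcedDistortion hp0 hp hK h le_rfl
  have : (n : ℝ) ≠ 0 := by positivity
  simpa [this] using h1

end Code

/-! ### Small sets and independent restrictions of the source -/

section Source

variable {ι : Type*} [Fintype ι] [DecidableEq ι]

/-- Few sequences have small probability. -/
theorem sum_seqProb_le_card_mul {p a : ℝ} (hp0 : 0 < p) (hp : p < 1 / 2) (ha : 0 < a)
    (V : Finset (ι → Bool)) :
    ∑ v ∈ V, seqProb p v ≤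
      V.card * Real.exp (-(Fintype.card ι * Real.binEntropy p) + a * logRatio p) +
        Fintype.card ι / a ^ 2 := by
  have h1 := Finset.sum_add_sum_compl (typical ι p a) (seqProb p)
  rw [sum_seqProb] at h1
  have h2 := le_sum_typical (ι := ι) hp0 hp ha
  have h3 := Finset.sum_inter_add_sum_sdiff V (typical ι p a) (seqProb p)
  have h4 : ∑ v ∈ V \ typical ι p a, seqProb p v ≤ ∑ v ∈ (typical ι p a)ᶜ, seqProb p v :=
    Finset.sum_le_sum_of_subset_of_nonneg (fun v hv => by
      simpa using (Finset.mem_sdiff.1 hv).2) fun v _ _ => (seqProb_pos hp0 hp v).le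
  have h5 : ∑ v ∈ V ∩ typical ι p a, seqProb p v ≤
      V.card * Real.exp (-(Fintype.card ι * Real.binEntropy p) + a * logRatio p) := by
    refine (Finset.sum_le_card_nsmul _ _ _ fun v hv =>
      seqProb_le_of_mem_typical hp0 hp (Finset.mem_inter.1 hv).2).trans ?_
    rw [nsmul_eq_mul]
    refine mul_le_mul_of_nonneg_right ?_ (Real.exp_pos _).le
    exact_mod_cast Finset.card_le_card Finset.inter_subset_left
  linarith

/-- The restriction of a sequence to the positions satisfying a predicate. -/
def restrict (P : ι → Prop) (x : ι → Bool) : {j // P j} → Bool := fun j => x j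

theorem sum_seqProb_mul_restrict (p : ℝ) (P : ι → Prop) [DecidablePred P]
    (f : ({j // P j} → Bool) → ({j // ¬ P j} → Bool) → ℝ) :
    ∑ x : ι → Bool, seqProb p x * f (restrict P x) (restrict (fun j => ¬ P j) x) =
      ∑ u, ∑ v, seqProb p u * seqProb p v * f u v := by
  rw [← Fintype.sum_prod_type', ← (Equiv.piEquivPiSubtypeProd P fun _ => Bool).sum_comp]
  refine Finset.sum_congr rfl fun x _ => ?_
  have : seqProb p x = seqProb p (restrict P x) * seqProb p (restrict (fun j => ¬ P j) x) :=
    (Fintype.prod_subtype_mul_prod_subtype P fun j => bernoulli p (x j)).symm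
  rw [this]
  rfl

theorem sum_seqProb_mul_restrict_left (p : ℝ) (P : ι → Prop) [DecidablePred P]
    (f : ({j // P j} → Bool) → ℝ) :
    ∑ x : ι → Bool, seqProb p x * f (restrict P x) = ∑ u, seqProb p u * f u := by
  rw [sum_seqProb_mul_restrict p P fun u _ => f u]
  refine Finset.sum_congr rfl fun u _ => ?_
  rw [← Finset.sum_mul, ← Finset.mul_sum, sum_seqProb, mul_one]

end Source

/-! ### Converse bounds from lists of candidates -/

/-- Both log differences are nonnegative, so each weight may be lowered to the smaller one; then the
inequality is 4c₀c₁ ≤ (c₀ + c₁)². -/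
theorem min_mul_log_four_le {m₀ m₁ c₀ c₁ : ℝ} (hm₀ : 0 ≤ m₀) (hm₁ : 0 ≤ m₁) (hc₀ : 0 < c₀)
    (hc₁ : 0 < c₁) :
    min m₀ m₁ * Real.log 4 ≤ m₀ * (Real.log (c₀ + c₁) - Real.log c₀) +
      m₁ * (Real.log (c₀ + c₁) - Real.log c₁) := by
  have h0 : Real.log c₀ ≤ Real.log (c₀ + c₁) := Real.log_le_log hc₀ (by linarith)
  have h1 : Real.log c₁ ≤ Real.log (c₀ + c₁) := Real.log_le_log hc₁ (by linarith)
  have h2 : Real.log 4 + (Real.log c₀ + Real.log c₁) ≤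
      Real.log (c₀ + c₁) + Real.log (c₀ + c₁) := by
    rw [← Real.log_mul hc₀.ne' hc₁.ne', ← Real.log_mul (by norm_num) (by positivity),
      ← Real.log_mul (by positivity) (by positivity)]
    exact Real.log_le_log (by positivity) (by nlinarith [sq_nonneg (c₀ - c₁)])
  have h3 : 0 ≤ min m₀ m₁ := le_min hm₀ hm₁
  have h4 := mul_le_mul_of_nonneg_left h2 h3
  have h5 := mul_le_mul_of_nonneg_right (min_le_left m₀ m₁) (sub_nonneg.2 h0)
  have h6 := mul_le_mul_of_nonneg_right (min_le_right m₀ m₁) (sub_nonneg.2 h1)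
  linarith

namespace Code

variable {n K M : ℕ}

open Classical in
/-- The number of members of `S` that agree with `x` before position `q`. -/
def agreeing (S : Finset (Fin n → Bool)) (q : ℕ) (x : Fin n → Bool) : ℕ :=
  (S.filter fun y => ∀ j : Fin n, j.val < q → y j = x j).card

theorem past_eq_iff {x y : Fin n → Bool} {q : Fin n} :
    past x q = past y q ↔ ∀ j : Fin n, j.val < q.val → x j = y j :=
  ⟨fun h j hj => congrFun h ⟨j, hj⟩, fun h => funext fun j => h _ j.isLt⟩

/-- Predicting by weighted majority among `S` costs at most half a bit of `S` per symbol. -/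
theorem exists_predictor (μ : (Fin n → Bool) → ℝ) (hμ : ∀ x, 0 ≤ μ x) (S : Finset (Fin n → Bool))
    (q : Fin n) :
    ∃ z : (Fin q.val → Bool) → Bool,
      (∑ x ∈ S, μ x * hamming (x q) (z (past x q))) * Real.log 4 ≤
        ∑ x ∈ S, μ x * (Real.log (agreeing S q.val x) - Real.log (agreeing S (q.val + 1) x)) := by
  classical
  -- `A u b` collects the members of `S` with past `u` and next bit `b`; the predictor picks the
  -- heavier class.
  let A : (Fin q.val → Bool) → Bool → Finset (Fin n → Bool) := fun u b =>
    S.filter fun x => past x q = u ∧ x q = b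
  let m : (Fin q.val → Bool) → Bool → ℝ := fun u b => ∑ x ∈ A u b, μ x
  refine ⟨fun u => decide (m u false ≤ m u true), ?_⟩
  have hsplit : ∀ f : (Fin n → Bool) → ℝ,
      ∑ x ∈ S, f x = ∑ u, (∑ x ∈ A u false, f x + ∑ x ∈ A u true, f x) := by
    intro f
    rw [← Finset.sum_fiberwise S (fun x => past x q)]
    refine Finset.sum_congr rfl fun u _ => ?_
    rw [← Finset.sum_filter_add_sum_filter_not _ fun x => x q = false, Finset.filter_filter,
      Finset.filter_filter]
    simp only [Bool.not_eq_false, A]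
  rw [hsplit, hsplit, Finset.sum_mul]
  refine Finset.sum_le_sum fun u _ => ?_
  have hm : ∀ b, 0 ≤ m u b := fun b => Finset.sum_nonneg fun x _ => hμ x
  have hl : ∀ b, ∑ x ∈ A u b, μ x * hamming (x q) (decide (m (past x q) false ≤ m (past x q) true))
      = m u b * hamming b (decide (m u false ≤ m u true)) := by
    intro b
    rw [Finset.sum_mul]
    refine Finset.sum_congr rfl fun x hx => ?_
    obtain ⟨-, rfl, rfl⟩ := Finset.mem_filter.1 hx
    rfl
  have hc : ∀ b, ∀ x ∈ A u b, agreeing S (q.val + 1) x = (A u b).card := by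
    intro b x hx
    obtain ⟨-, rfl, rfl⟩ := Finset.mem_filter.1 hx
    refine congrArg Finset.card (Finset.filter_congr fun y _ => ?_)
    rw [past_eq_iff]
    constructor
    · exact fun h => ⟨fun j hj => h j (by omega), h q (by omega)⟩
    · rintro ⟨h1, h2⟩ j hj
      rcases Nat.lt_succ_iff_lt_or_eq.1 hj with h | h
      · exact h1 j h
      · rwa [Fin.ext h]
  have hc' : ∀ b, ∀ x ∈ A u b, agreeing S q.val x = (A u false).card + (A u true).card := by
    intro b x hx
    obtain ⟨-, rfl, -⟩ := Finset.mem_filter.1 hx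
    rw [agreeing, ← Finset.card_filter_add_card_filter_not fun x => x q = false,
      Finset.filter_filter, Finset.filter_filter]
    simp only [Bool.not_eq_false, A, past_eq_iff]
  have hr : ∀ b, ∑ x ∈ A u b,
        μ x * (Real.log (agreeing S q.val x) - Real.log (agreeing S (q.val + 1) x)) =
      m u b * (Real.log ((A u false).card + (A u true).card) - Real.log (A u b).card) := by
    intro b
    rw [Finset.sum_mul]
    refine Finset.sum_congr rfl fun x hx => ?_
    rw [hc b x hx, hc' b x hx, Nat.cast_add]
  rw [hl, hl, hr, hr]
  have hmin : m u false * hamming false (decide (m u false ≤ m u true)) +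
      m u true * hamming true (decide (m u false ≤ m u true)) = min (m u false) (m u true) := by
    by_cases h : m u false ≤ m u true
    · simp [h, hamming]
    · simp [h, hamming, min_eq_right (not_le.1 h).le]
  rw [hmin]
  have hz : ∀ b, A u b = ∅ → m u b = 0 := fun b h => by simp only [m, h, Finset.sum_empty]
  -- If a class is empty the predictor never errs on `S` here and the list does not shrink: both
  -- sides are zero.
  rcases Finset.eq_empty_or_nonempty (A u false) with h0 | h0
  · rw [hz _ h0, min_eq_left (hm true), h0]
    simp
  rcases Finset.eq_empty_or_nonempty (A u true) with h1 | h1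
  · rw [hz _ h1, min_eq_right (hm false), h1]
    simp
  exact min_mul_log_four_le (hm _) (hm _) (by exact_mod_cast h0.card_pos)
    (by exact_mod_cast h1.card_pos)

/-- The sum telescopes. The last term is the logarithm of a positive count, since `x` agrees with
itself. -/
theorem sum_log_agreeing_le {S : Finset (Fin n → Bool)} {x : Fin n → Bool} (hx : x ∈ S) :
    ∑ q : Fin n, (Real.log (agreeing S q.val x) - Real.log (agreeing S (q.val + 1) x)) ≤
      Real.log S.card := by
  rw [Fin.sum_univ_eq_sum_range
    (fun q => Real.log (agreeing S q x) - Real.log (agreeing S (q + 1) x)), Finset.sum_range_sub']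
  have h0 : agreeing S 0 x = S.card := by simp [agreeing]
  have h1 : 1 ≤ agreeing S n x := Finset.card_pos.2 ⟨x, Finset.mem_filter.2 ⟨hx, by simp⟩⟩
  have h2 : 0 ≤ Real.log (agreeing S n x) := Real.log_nonneg (by exact_mod_cast h1)
  rw [h0]
  linarith

variable (c : Code Bool n K M)

/-- Whoever knows the message can list as many candidates for the source sequence as there are
keys, and the sequence is among them whenever the decoder succeeds. -/
theorem exists_candidates {p : ℝ} (hp0 : 0 < p) (hp : p < 1 / 2) :
    ∃ S : Fin M → Finset (Fin n → Bool), (∀ i, (S i).card ≤ K) ∧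
      c.successProb (bernoulli p) ≤ ∑ i, ∑ x ∈ S i, c.jointProb (bernoulli p) x i := by
  classical
  let w : Fin M → Fin K → (Fin n → Bool) → ℝ := fun i ω x =>
    seqProb p x * (K : ℝ)⁻¹ * (c.enc x ω).1 i
  have hw : ∀ i ω x, 0 ≤ w i ω x := fun i ω x =>
    mul_nonneg (mul_nonneg (seqProb_pos hp0 hp x).le (by positivity)) ((c.enc x ω).2.1 i)
  -- The most likely source sequence for each message and key does at least as well as any
  -- randomized decoder.
  have hmax : ∀ i ω, ∃ y, ∀ x, w i ω x ≤ w i ω y := fun i ω => Finite.exists_max _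
  choose g hg using hmax
  refine ⟨fun i => Finset.univ.image (g i), fun i => by
    simpa using Finset.card_image_le (s := Finset.univ) (f := g i), ?_⟩
  have h1 : c.successProb (bernoulli p) = ∑ i, ∑ ω, ∑ x, w i ω x * (c.dec i ω).1 x := by
    rw [successProb]
    simp only [w]
    calc _ = ∑ ω : Fin K, ∑ x : Fin n → Bool, ∑ i : Fin M,
          (∏ j, bernoulli p (x j)) * (K : ℝ)⁻¹ * (c.enc x ω).1 i * (c.dec i ω).1 x :=
          Finset.sum_comm
      _ = ∑ ω : Fin K, ∑ i : Fin M, ∑ x : Fin n → Bool,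
          (∏ j, bernoulli p (x j)) * (K : ℝ)⁻¹ * (c.enc x ω).1 i * (c.dec i ω).1 x :=
          Finset.sum_congr rfl fun ω _ => Finset.sum_comm
      _ = _ := Finset.sum_comm
  rw [h1]
  refine Finset.sum_le_sum fun i _ => ?_
  have h2 : ∀ ω, ∑ x, w i ω x * (c.dec i ω).1 x ≤
      ∑ x ∈ Finset.univ.image (g i), w i ω x := by
    intro ω
    calc _ ≤ ∑ x, w i ω (g i ω) * (c.dec i ω).1 x :=
          Finset.sum_le_sum fun x _ => mul_le_mul_of_nonneg_right (hg i ω x) ((c.dec i ω).2.1 x)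
      _ = w i ω (g i ω) := by rw [← Finset.mul_sum, (c.dec i ω).2.2, mul_one]
      _ ≤ _ := Finset.single_le_sum (f := w i ω) (fun x _ => hw i ω x)
          (Finset.mem_image_of_mem _ (Finset.mem_univ ω))
  refine (Finset.sum_le_sum fun ω _ => h2 ω).trans (le_of_eq ?_)
  rw [Finset.sum_comm]
  refine Finset.sum_congr rfl fun x _ => ?_
  simp only [w, jointProb, seqProb, Finset.mul_sum, mul_assoc]

theorem sum_sum_mem_le_one (hK : 1 ≤ K) {p : ℝ} (hp0 : 0 < p) (hp : p < 1 / 2)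
    (S : Fin M → Finset (Fin n → Bool)) :
    ∑ i, ∑ x ∈ S i, c.jointProb (bernoulli p) x i ≤ 1 := by
  rw [← c.sum_sum_jointProb hK p]
  exact Finset.sum_le_sum fun i _ =>
    Finset.sum_le_univ_sum_of_nonneg fun x => c.jointProb_nonneg hp0 hp x i

theorem successProb_le_one (hK : 1 ≤ K) {p : ℝ} (hp0 : 0 < p) (hp : p < 1 / 2) :
    c.successProb (bernoulli p) ≤ 1 := by
  obtain ⟨S, -, h⟩ := c.exists_candidates hp0 hp
  exact h.trans (c.sum_sum_mem_le_one hK hp0 hp S)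

theorem revealProb_le_one (hK : 1 ≤ K) {p : ℝ} (hp0 : 0 < p) (hp : p < 1 / 2) (m : ℕ)
    (r : Fin M → Fin n → Bool) : c.revealProb (bernoulli p) m r ≤ 1 := by
  rw [← c.sum_sum_jointProb hK p, Finset.sum_comm, revealProb, prob]
  refine Finset.sum_le_sum fun x _ => Finset.sum_le_sum fun i _ => ?_
  split_ifs
  · exact le_rfl
  · exact c.jointProb_nonneg hp0 hp x i

/-- The distortion forced is at most half the key rate, up to the error probability. -/
theorem forcedDistortion_le_log (hn : 1 ≤ n) (hK : 1 ≤ K) {p : ℝ} (hp0 : 0 < p)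
    (hp : p < 1 / 2) :
    c.forcedDistortion (bernoulli p) hamming ≤
      (n : ℝ)⁻¹ * (Real.log K / Real.log 4) + (1 - c.successProb (bernoulli p)) := by
  classical
  obtain ⟨S, hS, hsucc⟩ := c.exists_candidates hp0 hp
  have hz := fun (q : Fin n) (i : Fin M) => exists_predictor
    (fun x => c.jointProb (bernoulli p) x i) (fun x => c.jointProb_nonneg hp0 hp x i) (S i) q
  choose z hz using hz
  refine (c.forcedDistortion_le p z).trans ?_
  have hn' : (n : ℝ) ≠ 0 := by positivity
  have hlog : 0 < Real.log 4 := Real.log_pos (by norm_num)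
  have h1 : ∀ q, c.expectedDistortion (bernoulli p) hamming q (z q) ≤
      (∑ i, ∑ x ∈ S i, c.jointProb (bernoulli p) x i * (Real.log (agreeing (S i) q.val x) -
        Real.log (agreeing (S i) (q.val + 1) x))) / Real.log 4 +
      (1 - c.successProb (bernoulli p)) := by
    intro q
    rw [expectedDistortion, Finset.sum_comm]
    -- On the candidates the predictor pays in list size; off them the distortion is at most 1,
    -- which in total costs at most the error probability.
    have h2 : ∀ i, ∑ x, c.jointProb (bernoulli p) x i * hamming (x q) (z q i (past x q)) ≤
        (∑ x ∈ S i, c.jointProb (bernoulli p) x i * (Real.log (agreeing (S i) q.val x) -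
          Real.log (agreeing (S i) (q.val + 1) x))) / Real.log 4 +
        (∑ x, c.jointProb (bernoulli p) x i - ∑ x ∈ S i, c.jointProb (bernoulli p) x i) := by
      intro i
      rw [← Finset.sum_add_sum_compl (S i),
        ← Finset.sum_add_sum_compl (S i) fun x => c.jointProb (bernoulli p) x i,
        add_sub_cancel_left]
      refine add_le_add ((le_div_iff₀ hlog).2 (hz q i)) (Finset.sum_le_sum fun x _ => ?_)
      exact mul_le_of_le_one_right (c.jointProb_nonneg hp0 hp x i) (hamming_le_one _ _)
    refine (Finset.sum_le_sum fun i _ => h2 i).trans ?_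
    rw [Finset.sum_add_distrib, Finset.sum_sub_distrib, c.sum_sum_jointProb hK, Finset.sum_div]
    linarith
  have h3 : ∑ q : Fin n, ∑ i, ∑ x ∈ S i, c.jointProb (bernoulli p) x i *
      (Real.log (agreeing (S i) q.val x) - Real.log (agreeing (S i) (q.val + 1) x)) ≤
      Real.log K := by
    rw [Finset.sum_comm]
    have hlogK : 0 ≤ Real.log K := Real.log_nonneg (by exact_mod_cast hK)
    calc _ ≤ ∑ i, ∑ x ∈ S i, c.jointProb (bernoulli p) x i * Real.log K := by
          refine Finset.sum_le_sum fun i _ => ?_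
          rw [Finset.sum_comm]
          refine Finset.sum_le_sum fun x hx => ?_
          rw [← Finset.mul_sum]
          refine mul_le_mul_of_nonneg_left ?_ (c.jointProb_nonneg hp0 hp x i)
          refine (sum_log_agreeing_le hx).trans (Real.log_le_log ?_ (by exact_mod_cast hS i))
          exact_mod_cast Finset.card_pos.2 ⟨x, hx⟩
      _ ≤ 1 * Real.log K := by
          simp only [← Finset.sum_mul]
          exact mul_le_mul_of_nonneg_right (c.sum_sum_mem_le_one hK hp0 hp S) hlogK
      _ = _ := one_mul _
  refine (mul_le_mul_of_nonneg_left (Finset.sum_le_sum fun q _ => h1 q)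
    (by positivity)).trans ?_
  rw [Finset.sum_add_distrib, ← Finset.sum_div, Finset.sum_const, Finset.card_univ,
    Fintype.card_fin, nsmul_eq_mul, mul_add, inv_mul_cancel_left₀ hn']
  gcongr

/-- A perfectly hidden prefix requires a long enough key. -/
theorem HidesPrefix.successProb_le {c : Code Bool n K M} {p a : ℝ} {m : ℕ} (hp0 : 0 < p)
    (hp : p < 1 / 2) (hK : 1 ≤ K) (h : c.HidesPrefix (bernoulli p) m) (hm : m ≤ n)
    (ha : 0 < a) :
    c.successProb (bernoulli p) ≤
      K * Real.exp (-(m * Real.binEntropy p) + a * logRatio p) + m / a ^ 2 := by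
  classical
  obtain ⟨S, hS, hsucc⟩ := c.exists_candidates hp0 hp
  refine hsucc.trans ?_
  have hcard : Fintype.card {j : Fin n // j.val < m} = m := by
    rw [Fintype.card_subtype, Fin.card_filter_val_lt, min_eq_right hm]
  let V : Fin M → Finset ({j : Fin n // j.val < m} → Bool) := fun i => (S i).image (restrict _)
  -- By independence, the joint weight of the list is at most the message probability times the
  -- source probability of the at most `K` prefixes that occur in the list.
  have h1 : ∀ i, ∑ x ∈ S i, c.jointProb (bernoulli p) x i ≤
      (∑ x, c.jointProb (bernoulli p) x i) * ∑ u ∈ V i, seqProb p u := by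
    intro i
    calc _ ≤ ∑ x, c.jointProb (bernoulli p) x i *
          (if restrict (fun j : Fin n => j.val < m) x ∈ V i then 1 else 0) := by
          rw [← Finset.sum_filter_add_sum_filter_not Finset.univ (· ∈ S i)]
          refine le_add_of_le_of_nonneg (le_of_eq ?_) (Finset.sum_nonneg fun x _ =>
            mul_nonneg (c.jointProb_nonneg hp0 hp x i) (by split_ifs <;> norm_num))
          rw [Finset.filter_mem_eq_inter, Finset.univ_inter]
          refine Finset.sum_congr rfl fun x hx => ?_
          rw [if_pos (Finset.mem_image_of_mem _ hx), mul_one]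
      _ = _ := by
          rw [h.sum_mul hK fun x => if restrict (fun j : Fin n => j.val < m) x ∈ V i then 1 else 0]
          · rw [sum_seqProb_mul_restrict_left p (fun j : Fin n => j.val < m)
              fun u => if u ∈ V i then 1 else 0]
            simp
          · intro x y hxy
            have : restrict (fun j : Fin n => j.val < m) x = restrict _ y :=
              funext fun j => hxy j j.2
            rw [this]
  have h2 : ∀ i, ∑ u ∈ V i, seqProb p u ≤
      K * Real.exp (-(m * Real.binEntropy p) + a * logRatio p) + m / a ^ 2 := by
    intro i
    have := sum_seqProb_le_card_mul hp0 hp ha (V i)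
    rw [hcard] at this
    refine this.trans ?_
    gcongr
    exact Finset.card_image_le.trans (hS i)
  calc _ ≤ ∑ i, (∑ x, c.jointProb (bernoulli p) x i) *
        (K * Real.exp (-(m * Real.binEntropy p) + a * logRatio p) + m / a ^ 2) :=
        Finset.sum_le_sum fun i _ => (h1 i).trans (mul_le_mul_of_nonneg_left (h2 i)
          (Finset.sum_nonneg fun x _ => c.jointProb_nonneg hp0 hp x i))
    _ = _ := by rw [← Finset.sum_mul, c.sum_sum_jointProb hK, one_mul]

/-- The eavesdropper guesses 0 in the prefix and follows `r` after it. -/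
theorem forcedDistortion_le_prefix (hn : 1 ≤ n) (hK : 1 ≤ K) {p : ℝ} (hp0 : 0 < p)
    (hp : p < 1 / 2) {m : ℕ} (hm : m ≤ n) (r : Fin M → Fin n → Bool) :
    c.forcedDistortion (bernoulli p) hamming ≤
      m / n * p + (1 - c.revealProb (bernoulli p) m r) := by
  classical
  refine (c.forcedDistortion_le p fun q i _ => if q.val < m then false else r i q).trans ?_
  have hn' : (n : ℝ) ≠ 0 := by positivity
  have htot : ∑ x, ∑ i, c.jointProb (bernoulli p) x i = 1 := by
    rw [Finset.sum_comm, c.sum_sum_jointProb hK]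
  have hrev := c.revealProb_le_one hK hp0 hp m r
  have h1 : ∀ q : Fin n, c.expectedDistortion (bernoulli p) hamming q
      (fun i _ => if q.val < m then false else r i q) ≤
      (if q.val < m then p else 0) + (1 - c.revealProb (bernoulli p) m r) := by
    intro q
    by_cases hq : q.val < m
    · simp only [hq, if_true]
      rw [c.expectedDistortion_const_false hK]
      linarith
    · simp only [hq, if_false, zero_add]
      rw [← htot, revealProb, prob, expectedDistortion, ← Finset.sum_sub_distrib]
      refine Finset.sum_le_sum fun x _ => ?_
      rw [← Finset.sum_sub_distrib]
      refine Finset.sum_le_sum fun i _ => ?_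
      split_ifs with h
      · simp [hamming, h q (not_lt.1 hq)]
      · simpa using mul_le_of_le_one_right (c.jointProb_nonneg hp0 hp x i) (hamming_le_one _ _)
  refine (mul_le_mul_of_nonneg_left (Finset.sum_le_sum fun q _ => h1 q) (by positivity)).trans ?_
  rw [Finset.sum_add_distrib, ← Finset.sum_filter, Finset.sum_const, Finset.sum_const,
    Fin.card_filter_val_lt, min_eq_right hm, Finset.card_univ, Fintype.card_fin, nsmul_eq_mul,
    nsmul_eq_mul, mul_add, inv_mul_cancel_left₀ hn', div_eq_inv_mul, mul_assoc]

end Code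

/-! ### Deterministic codes and the one-time pad on a prefix -/

theorem exists_injOn_fin {α : Type*} (T : Finset α) {N : ℕ} (hN : 1 ≤ N) (h : T.card ≤ N) :
    ∃ f : α → Fin N, Set.InjOn f T := by
  classical
  refine ⟨fun x => if hx : x ∈ T then Fin.castLE h (T.equivFin ⟨x, hx⟩) else ⟨0, hN⟩, ?_⟩
  intro x hx y hy hxy
  have hx' : x ∈ T := hx
  have hy' : y ∈ T := hy
  simp only [hx', hy', dif_pos] at hxy
  simpa using hxy

/-- Pairs as messages. -/
def pairEmb {N L M : ℕ} (h : N * L ≤ M) : Fin N × Fin L ↪ Fin M :=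
  finProdFinEquiv.toEmbedding.trans (Fin.castLEEmb h)

/-- The first component of the pair that a message stands for. -/
def pairFst {N L M : ℕ} (h : N * L ≤ M) (hN : 1 ≤ N) (i : Fin M) : Fin N :=
  open Classical in if hi : ∃ a, pairEmb h a = i then hi.choose.1 else ⟨0, hN⟩

theorem pairFst_pairEmb {N L M : ℕ} (h : N * L ≤ M) (hN : 1 ≤ N) (a : Fin N × Fin L) :
    pairFst h hN (pairEmb h a) = a.1 := by
  have hi : ∃ b, pairEmb h b = pairEmb h a := ⟨a, rfl⟩
  rw [pairFst, dif_pos hi, (pairEmb h).injective hi.choose_spec]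

namespace Code

variable {n K M : ℕ}

open Classical in
/-- An encoding function that is injective on `G` for every key value gives a code that succeeds
on `G`. -/
theorem exists_code (hK : 1 ≤ K) (f : (Fin n → Bool) → Fin K → Fin M)
    (G : Finset (Fin n → Bool)) (hf : ∀ ω, Set.InjOn (fun x => f x ω) G) :
    ∃ c : Code Bool n K M, c.IsDeterministic ∧
      (∀ p x i, c.jointProb (bernoulli p) x i =
        seqProb p x * ((Finset.univ.filter fun ω => f x ω = i).card * (K : ℝ)⁻¹)) ∧
      ∀ p : ℝ, 0 < p → p < 1 / 2 → ∑ x ∈ G, seqProb p x ≤ c.successProb (bernoulli p) := by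
  -- The decoder inverts the encoder on `G`, separately for each key value.
  let g : Fin M → Fin K → (Fin n → Bool) := fun i ω => Function.invFunOn (fun x => f x ω) G i
  have hg : ∀ x ∈ G, ∀ ω, g (f x ω) ω = x := fun x hx ω => (hf ω).leftInvOn_invFunOn hx
  let c : Code Bool n K M :=
    { enc := fun x ω => ⟨fun i => if f x ω = i then 1 else 0,
        fun i => by dsimp only; split_ifs <;> norm_num, by simp⟩
      dec := fun i ω => ⟨fun x => if g i ω = x then 1 else 0,
        fun x => by dsimp only; split_ifs <;> norm_num, by simp⟩ }
  refine ⟨c, ⟨f, g, fun _ _ _ => by simp only [c],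
    fun _ _ _ => by simp only [c]; congr⟩, fun p x i => ?_, fun p hp0 hp => ?_⟩
  · simp only [jointProb, c, seqProb, ← Finset.mul_sum, Finset.sum_boole]
    rw [mul_comm (K : ℝ)⁻¹]
  · rw [successProb, ← Finset.sum_add_sum_compl G]
    refine le_add_of_le_of_nonneg (Finset.sum_le_sum fun x hx => ?_)
      (Finset.sum_nonneg fun x _ => Finset.sum_nonneg fun ω _ => Finset.sum_nonneg fun i _ =>
        mul_nonneg (mul_nonneg (mul_nonneg (seqProb_pos hp0 hp x).le (by positivity))
          ((c.enc x ω).2.1 i)) ((c.dec i ω).2.1 x))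
    have h1 : ∀ ω, ∑ i, (∏ j, bernoulli p (x j)) * (K : ℝ)⁻¹ * (c.enc x ω).1 i * (c.dec i ω).1 x =
        seqProb p x * (K : ℝ)⁻¹ := by
      intro ω
      rw [Finset.sum_eq_single (f x ω)]
      · simp [c, hg x hx, seqProb]
      · intro i _ hi
        simp [c, hi.symm]
      · simp
    have hK' : (K : ℝ) ≠ 0 := by positivity
    simp only [h1]
    simp [mul_comm (seqProb p x), hK']

/-- A message that depends on the source through a suffix (and on independent randomness) hides
the complementary prefix. -/
theorem hidesPrefix_of_jointProb_eq {c : Code Bool n K M} {p : ℝ} {m : ℕ} (hK : 1 ≤ K)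
    (κ : ({j : Fin n // ¬ j.val < m} → Bool) → Fin M → ℝ)
    (h : ∀ x i, c.jointProb (bernoulli p) x i = seqProb p x * κ (restrict _ x) i) :
    c.HidesPrefix (bernoulli p) m := by
  classical
  intro u i
  rw [prob_and_eq, c.prob_fst hK, prob_snd_eq]
  simp only [h]
  let A : ({j : Fin n // j.val < m} → Bool) → ℝ := fun v => if v = restrict _ u then 1 else 0
  have hA : ∀ x : Fin n → Bool, (∀ j : Fin n, j.val < m → x j = u j) ↔
      restrict (fun j : Fin n => j.val < m) x = restrict (fun j : Fin n => j.val < m) u :=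
    fun x => ⟨fun hx => funext fun j => hx j j.2, fun hx j hj => congrFun hx ⟨j, hj⟩⟩
  have h1 : ∀ x : Fin n → Bool,
      (if ∀ j : Fin n, j.val < m → x j = u j then seqProb p x * κ (restrict _ x) i else 0) =
      seqProb p x * (A (restrict (fun j : Fin n => j.val < m) x) * κ (restrict _ x) i) := by
    intro x
    simp only [A, ← hA]
    split_ifs <;> simp
  have h2 : ∀ x : Fin n → Bool,
      (if ∀ j : Fin n, j.val < m → x j = u j then seqProb p x else 0) =
      seqProb p x * (A (restrict (fun j : Fin n => j.val < m) x)) := by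
    intro x
    simp only [A, ← hA]
    split_ifs <;> simp
  simp only [h1, h2]
  rw [sum_seqProb_mul_restrict p (fun j : Fin n => j.val < m) fun v w => A v * κ w i,
    sum_seqProb_mul_restrict p (fun j : Fin n => j.val < m) fun v _ => A v,
    sum_seqProb_mul_restrict p (fun j : Fin n => j.val < m) fun _ w => κ w i]
  have h3 : ∀ v : {j : Fin n // j.val < m} → Bool,
      ∑ w : {j : Fin n // ¬ j.val < m} → Bool, seqProb p v * seqProb p w * A v =
        seqProb p v * A v := by
    intro v
    rw [← Finset.sum_mul, ← Finset.mul_sum, sum_seqProb, mul_one]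
  have h4 : ∑ v : {j : Fin n // j.val < m} → Bool, ∑ w : {j : Fin n // ¬ j.val < m} → Bool,
      seqProb p v * seqProb p w * κ w i = ∑ w, seqProb p w * κ w i := by
    rw [Finset.sum_comm]
    refine Finset.sum_congr rfl fun w _ => ?_
    rw [← Finset.sum_mul, ← Finset.sum_mul, sum_seqProb, one_mul]
  rw [h4, Finset.sum_congr rfl fun v _ => h3 v, Finset.sum_mul]
  refine Finset.sum_congr rfl fun v _ => ?_
  rw [Finset.mul_sum]
  refine Finset.sum_congr rfl fun w _ => ?_
  ring

/-- A code that sends nothing. -/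
theorem exists_constant_code (n : ℕ) (hK : 1 ≤ K) (hM : 1 ≤ M) :
    ∃ c : Code Bool n K M, c.IsDeterministic ∧
      ∀ (p : ℝ) (m : ℕ), c.HidesPrefix (bernoulli p) m := by
  classical
  obtain ⟨c, hc, hj, -⟩ := exists_code (n := n) hK (fun _ _ => (⟨0, hM⟩ : Fin M)) ∅ (by simp)
  exact ⟨c, hc, fun p m => hidesPrefix_of_jointProb_eq hK
    (fun _ i => (Finset.univ.filter fun _ : Fin K => (⟨0, hM⟩ : Fin M) = i).card * (K : ℝ)⁻¹)
    fun x i => hj p x i⟩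

/-- One-time pad on the index of a prefix in `T₁`, and the index of the suffix in `T₂`. -/
theorem exists_prefix_code {N m : ℕ} (hK : 1 ≤ K) (hN : 1 ≤ N) (hM : N * K ≤ M)
    (T₁ : Finset ({j : Fin n // j.val < m} → Bool))
    (T₂ : Finset ({j : Fin n // ¬ j.val < m} → Bool)) (hT₁ : T₁.card ≤ K) (hT₂ : T₂.card ≤ N) :
    ∃ (c : Code Bool n K M) (r : Fin M → Fin n → Bool), c.IsDeterministic ∧
      ∀ p : ℝ, 0 < p → p < 1 / 2 → c.HidesPrefix (bernoulli p) m ∧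
        ∑ v ∈ T₂, seqProb p v ≤ c.revealProb (bernoulli p) m r ∧
        (∑ u ∈ T₁, seqProb p u) * ∑ v ∈ T₂, seqProb p v ≤ c.successProb (bernoulli p) := by
  classical
  obtain ⟨ψ, hψ⟩ := exists_injOn_fin T₁ hK hT₁
  obtain ⟨φ, hφ⟩ := exists_injOn_fin T₂ hN hT₂
  have : NeZero K := ⟨by omega⟩
  -- The suffix index is sent in the clear; the prefix index is shifted modulo `K` by the key.
  let f : (Fin n → Bool) → Fin K → Fin M := fun x ω =>
    pairEmb hM (φ (restrict _ x), ψ (restrict _ x) + ω)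
  let G : Finset (Fin n → Bool) := Finset.univ.filter fun x =>
    restrict (fun j : Fin n => j.val < m) x ∈ T₁ ∧
      restrict (fun j : Fin n => ¬ j.val < m) x ∈ T₂
  have hf : ∀ ω, Set.InjOn (fun x => f x ω) G := by
    intro ω x hx y hy hxy
    simp only [G, Finset.coe_filter, Finset.mem_univ, true_and, Set.mem_ofPred_eq] at hx hy
    have h := (pairEmb hM).injective hxy
    simp only [Prod.mk.injEq, add_left_inj] at h
    have h1 := hφ hx.2 hy.2 h.1
    have h2 := hψ hx.1 hy.1 h.2
    funext j
    by_cases hj : j.val < m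
    · exact congrFun h2 ⟨j, hj⟩
    · exact congrFun h1 ⟨j, hj⟩
  obtain ⟨c, hc, hjoint, hsucc⟩ := exists_code hK f G hf
  let D : Fin N → ({j : Fin n // ¬ j.val < m} → Bool) := Function.invFunOn φ T₂
  have hD : ∀ v ∈ T₂, D (φ v) = v := fun v hv => hφ.leftInvOn_invFunOn hv
  let r : Fin M → Fin n → Bool := fun i j =>
    if hj : ¬ j.val < m then D (pairFst hM hN i) ⟨j, hj⟩ else false
  refine ⟨c, r, hc, fun p hp0 hp => ⟨?_, ?_, ?_⟩⟩
  · refine hidesPrefix_of_jointProb_eq hK (fun w i => (Finset.univ.filter fun b : Fin K =>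
      pairEmb hM (φ w, b) = i).card * (K : ℝ)⁻¹) fun x i => ?_
    rw [hjoint]
    congr 3
    -- Translation by the prefix index permutes the keys, so the law of the message depends on the
    -- suffix alone.
    refine Finset.card_bij (fun ω _ => ψ (restrict _ x) + ω) ?_ ?_ ?_
    · intro ω hω
      simpa [f] using hω
    · intro a _ b _ hab
      simpa using hab
    · intro b hb
      refine ⟨b - ψ (restrict _ x), ?_, by simp⟩
      simpa [f] using hb
  · have h1 := sum_seqProb_mul_restrict p (fun j : Fin n => j.val < m)
      fun _ v => if v ∈ T₂ then 1 else 0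
    have h2 : ∑ v ∈ T₂, seqProb p v = ∑ x : Fin n → Bool, seqProb p x *
        (if restrict (fun j : Fin n => ¬ j.val < m) x ∈ T₂ then 1 else 0) := by
      rw [h1, Finset.sum_comm]
      simp only [← Finset.sum_mul, sum_seqProb, one_mul]
      simp
    rw [h2, revealProb, prob]
    refine Finset.sum_le_sum fun x _ => ?_
    split_ifs with hx
    · rw [mul_one, ← c.sum_jointProb hK]
      refine Finset.sum_le_sum fun i _ => ?_
      split_ifs with hr
      · exact le_rfl
      · rw [hjoint]
        refine le_of_eq ?_
        have : (Finset.univ.filter fun ω => f x ω = i) = ∅ := by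
          refine Finset.filter_eq_empty_iff.2 fun ω _ hω => hr fun j hj => ?_
          have hj' : ¬ j.val < m := not_lt.2 hj
          simp only [r, hj', not_false_eq_true, dif_pos, ← hω, f, pairFst_pairEmb, hD _ hx]
          rfl
        rw [this]
        simp
    · rw [mul_zero]
      refine Finset.sum_nonneg fun i _ => ?_
      split_ifs
      · exact c.jointProb_nonneg hp0 hp x i
      · exact le_rfl
  · refine le_trans (le_of_eq ?_) (hsucc p hp0 hp)
    have h1 := sum_seqProb_mul_restrict p (fun j : Fin n => j.val < m)
      fun u v => (if u ∈ T₁ then 1 else 0) * (if v ∈ T₂ then 1 else 0)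
    have h2 : ∑ x ∈ G, seqProb p x = ∑ x : Fin n → Bool, seqProb p x *
        ((if restrict (fun j : Fin n => j.val < m) x ∈ T₁ then 1 else 0) *
          (if restrict (fun j : Fin n => ¬ j.val < m) x ∈ T₂ then 1 else 0)) := by
      rw [Finset.sum_filter]
      refine Finset.sum_congr rfl fun x _ => ?_
      by_cases ha : restrict (fun j : Fin n => j.val < m) x ∈ T₁ <;>
        by_cases hb : restrict (fun j : Fin n => ¬ j.val < m) x ∈ T₂ <;> simp [ha, hb]
    have h3 : ∀ u : {j : Fin n // j.val < m} → Bool,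
        ∑ v : {j : Fin n // ¬ j.val < m} → Bool, seqProb p u * seqProb p v *
          ((if u ∈ T₁ then 1 else 0) * (if v ∈ T₂ then 1 else 0)) =
        if u ∈ T₁ then seqProb p u * ∑ v ∈ T₂, seqProb p v else 0 := by
      intro u
      split_ifs <;> simp [Finset.mul_sum]
    rw [h2, h1, Finset.sum_congr rfl fun u _ => h3 u, Finset.sum_ite_mem, Finset.univ_inter,
      Finset.sum_mul]

end Code

/-! ### Covering the typical sequences by cubes -/

section Cubes

variable {ι : Type*} [Fintype ι] [DecidableEq ι]

/-- The sequences that are free on `u.1` and whose ones off `u.1` are the members of `u.2`. -/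
def cube (u : Finset ι × Finset ι) : Finset (ι → Bool) :=
  Finset.univ.filter fun x => ∀ j, j ∉ u.1 → (x j = true ↔ j ∈ u.2)

theorem mem_cube {u : Finset ι × Finset ι} {x : ι → Bool} :
    x ∈ cube u ↔ ∀ j, j ∉ u.1 → (x j = true ↔ j ∈ u.2) := by
  simp [cube]

theorem card_cube_le (u : Finset ι × Finset ι) : (cube u).card ≤ 2 ^ u.1.card := by
  rw [← Finset.card_powerset]
  refine Finset.card_le_card_of_injOn (fun x => ones x ∩ u.1)
    (fun x _ => Finset.mem_coe.2 (Finset.mem_powerset.2 Finset.inter_subset_right)) ?_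
  intro x hx y hy hxy
  funext j
  rw [Bool.eq_iff_iff]
  by_cases hj : j ∈ u.1
  · have := Finset.ext_iff.1 hxy j
    simpa [ones, hj] using this
  · rw [mem_cube.1 hx j hj, mem_cube.1 hy j hj]

/-- The set `u.2 ∪ t` for some `t ⊆ u.1`. -/
def Covers (u : Finset ι × Finset ι) (s : Finset ι) : Prop := u.2 ⊆ s ∧ s ⊆ u.1 ∪ u.2

theorem Covers.mem_cube {u : Finset ι × Finset ι} {x : ι → Bool} (h : Covers u (ones x)) :
    x ∈ cube u := by
  rw [PartialSecrecy.mem_cube]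
  intro j hj
  have h1 : x j = true ↔ j ∈ ones x := by simp [ones]
  rw [h1]
  exact ⟨fun hx => (Finset.mem_union.1 (h.2 hx)).resolve_left hj, fun hx => h.1 hx⟩

open Classical in
/-- The pairs that cover sets of size `w`, with `2 * l` free positions. -/
def balancedPairs (ι : Type*) [Fintype ι] (w l : ℕ) : Finset (Finset ι × Finset ι) :=
  Finset.univ.filter fun u => u.1.card = 2 * l ∧ u.2.card = w - l ∧ Disjoint u.1 u.2

theorem mem_balancedPairs {w l : ℕ} {u : Finset ι × Finset ι} : u ∈ balancedPairs ι w l ↔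
    u.1.card = 2 * l ∧ u.2.card = w - l ∧ Disjoint u.1 u.2 := by
  simp [balancedPairs]

-- A covering pair amounts to a choice of `l` members of `s` and `l` non-members to be free. The
-- count does not depend on `s`, which is what the averaging argument needs.
open Classical in
theorem card_balancedPairs_filter {w l : ℕ} (hlw : l ≤ w) {s : Finset ι} (hs : s.card = w) :
    ((balancedPairs ι w l).filter fun u => Covers u s).card =
      w.choose l * (Fintype.card ι - w).choose l := by
  have h1 : (Finset.powersetCard l s ×ˢ Finset.powersetCard l sᶜ).card =
      w.choose l * (Fintype.card ι - w).choose l := by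
    rw [Finset.card_product, Finset.card_powersetCard, Finset.card_powersetCard,
      Finset.card_compl, hs]
  rw [← h1]
  have key : ∀ u ∈ (balancedPairs ι w l).filter fun u => Covers u s,
      s \ (s \ u.2) = u.2 ∧ (s \ u.2) ∪ (u.1 \ s) = u.1 ∧ (s \ u.2).card = l ∧
        (u.1 \ s).card = l := by
    intro u hu
    rw [Finset.mem_filter, mem_balancedPairs] at hu
    obtain ⟨⟨hE, hF, hd⟩, hFs, hsE⟩ := hu
    have a1 : s \ (s \ u.2) = u.2 :=
      Finset.sdiff_sdiff_eq_self hFs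
    have a2 : (s \ u.2) ∪ (u.1 \ s) = u.1 := by
      ext j
      have hj1 := @hsE j
      simp only [Finset.mem_union, Finset.mem_sdiff] at hj1 ⊢
      have hj3 := (Finset.disjoint_left.1 hd) (a := j)
      tauto
    have a3 : (s \ u.2).card = l := by
      rw [Finset.card_sdiff_of_subset hFs, hs, hF]
      omega
    refine ⟨a1, a2, a3, ?_⟩
    have a4 : Disjoint (s \ u.2) (u.1 \ s) :=
      Finset.disjoint_left.2 fun j hj hj' => (Finset.mem_sdiff.1 hj').2 (Finset.mem_sdiff.1 hj).1
    have a5 := Finset.card_union_of_disjoint a4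
    rw [a2, hE, a3] at a5
    omega
  refine Finset.card_nbij' (fun u => (s \ u.2, u.1 \ s)) (fun v => (v.1 ∪ v.2, s \ v.1))
    ?_ ?_ ?_ ?_
  · intro u hu
    obtain ⟨-, -, h3, h4⟩ := key u hu
    simp only [Finset.coe_product, Set.mem_prod, Finset.mem_coe, Finset.mem_powersetCard]
    exact ⟨⟨Finset.sdiff_subset, h3⟩, fun j hj => Finset.mem_compl.2 (Finset.mem_sdiff.1 hj).2, h4⟩
  · intro v hv
    simp only [Finset.coe_product, Set.mem_prod, Finset.mem_coe, Finset.mem_powersetCard] at hv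
    obtain ⟨⟨h1, h2⟩, h3, h4⟩ := hv
    have hd : Disjoint v.1 v.2 :=
      Finset.disjoint_left.2 fun j hj hj' => Finset.mem_compl.1 (h3 hj') (h1 hj)
    refine Finset.mem_coe.2 (Finset.mem_filter.2
      ⟨mem_balancedPairs.2 ⟨?_, ?_, ?_⟩, Finset.sdiff_subset, ?_⟩)
    · rw [Finset.card_union_of_disjoint hd]
      omega
    · rw [Finset.card_sdiff_of_subset h1, hs, h2]
    · rw [Finset.disjoint_left]
      intro j hj hj'
      rw [Finset.mem_sdiff] at hj'
      rcases Finset.mem_union.1 hj with h | h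
      · exact hj'.2 h
      · exact Finset.mem_compl.1 (h3 h) hj'.1
    · intro j hj
      by_cases h : j ∈ v.1 <;> simp [h, hj]
  · intro u hu
    obtain ⟨h1, h2, -, -⟩ := key u hu
    simp only [h1, h2]
  · intro v hv
    simp only [Finset.coe_product, Set.mem_prod, Finset.mem_coe, Finset.mem_powersetCard] at hv
    obtain ⟨⟨h1, h2⟩, h3, h4⟩ := hv
    have b1 : s \ (s \ v.1) = v.1 :=
      Finset.sdiff_sdiff_eq_self h1
    have b2 : (v.1 ∪ v.2) \ s = v.2 := by
      ext j
      have hj1 := @h1 j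
      have hj3 := @h3 j
      simp only [Finset.mem_union, Finset.mem_sdiff, Finset.mem_compl] at hj3 ⊢
      tauto
    simp only [b1, b2]

-- Adjoining to `u.2` any half of the free positions gives a set of size `w`.
open Classical in
theorem choose_le_card_filter_covers {w l : ℕ} (hlw : l ≤ w) {u : Finset ι × Finset ι}
    (hu : u ∈ balancedPairs ι w l) :
    (2 * l).choose l ≤ ((Finset.powersetCard w Finset.univ).filter fun s => Covers u s).card := by
  rw [mem_balancedPairs] at hu
  obtain ⟨hE, hF, hd⟩ := hu
  rw [← hE, ← Finset.card_powersetCard]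
  refine Finset.card_le_card_of_injOn (fun t => u.2 ∪ t) ?_ ?_
  · intro t ht
    rw [Finset.mem_coe, Finset.mem_powersetCard] at ht
    have hd' : Disjoint u.2 t := Disjoint.symm (Finset.disjoint_of_subset_left ht.1 hd)
    refine Finset.mem_coe.2 (Finset.mem_filter.2 ⟨Finset.mem_powersetCard.2
      ⟨Finset.subset_univ _, ?_⟩, Finset.subset_union_left, ?_⟩)
    · rw [Finset.card_union_of_disjoint hd']
      omega
    · rw [Finset.union_comm u.1]
      exact Finset.union_subset_union_right ht.1
  · intro t ht t' ht' h
    rw [Finset.mem_coe, Finset.mem_powersetCard] at ht ht'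
    ext j
    have h1 := Finset.ext_iff.1 h j
    have h2 := @ht.1 j
    have h3 := @ht'.1 j
    have h4 := (Finset.disjoint_left.1 hd) (a := j)
    simp only [Finset.mem_union] at h1
    tauto

open Classical in
/-- Some pair covers at least the average fraction of any family of `w`-sets. -/
theorem exists_covers_many {w l : ℕ} (hlw : l ≤ w) (hlw' : l ≤ Fintype.card ι - w)
    (hw : w ≤ Fintype.card ι) (U : Finset (Finset ι)) (hU : ∀ s ∈ U, s.card = w) :
    ∃ u : Finset ι × Finset ι, u.1.card = 2 * l ∧
      ((2 * l).choose l / (Fintype.card ι).choose w : ℝ) * U.card ≤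
        (U.filter fun s => Covers u s).card := by
  set d := w.choose l * (Fintype.card ι - w).choose l with hd
  have hdpos : 0 < d := Nat.mul_pos (Nat.choose_pos hlw) (Nat.choose_pos hlw')
  have hC : 0 < (Fintype.card ι).choose w := Nat.choose_pos hw
  -- Count the incidences between pairs and sets in two ways; every `w`-set lies in exactly `d` of
  -- the pairs.
  have hcount : ∀ V : Finset (Finset ι), (∀ s ∈ V, s.card = w) →
      ∑ u ∈ balancedPairs ι w l, (V.filter fun s => Covers u s).card = V.card * d := by
    intro V hV
    have h1 := Finset.sum_card_bipartiteAbove_eq_sum_card_bipartiteBelow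
      (s := balancedPairs ι w l) (t := V) fun u s => Covers u s
    simp only [Finset.bipartiteAbove, Finset.bipartiteBelow] at h1
    rw [h1, Finset.sum_congr rfl fun s hs => card_balancedPairs_filter hlw (hV s hs),
      Finset.sum_const, smul_eq_mul]
  have htotal : (balancedPairs ι w l).card * (2 * l).choose l ≤
      (Fintype.card ι).choose w * d := by
    have h1 := hcount (Finset.powersetCard w Finset.univ)
      fun s hs => (Finset.mem_powersetCard.1 hs).2
    rw [Finset.card_powersetCard, Finset.card_univ] at h1
    rw [← h1, ← smul_eq_mul]
    exact Finset.card_nsmul_le_sum _ _ _ fun u hu => choose_le_card_filter_covers hlw hu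
  have hne : (balancedPairs ι w l).Nonempty := by
    obtain ⟨s, -, hs⟩ := Finset.exists_subset_card_eq (s := (Finset.univ : Finset ι)) (n := w)
      (by rwa [Finset.card_univ])
    have h1 := card_balancedPairs_filter hlw hs
    rw [← hd] at h1
    exact (Finset.card_pos.1 (h1 ▸ hdpos)).mono (Finset.filter_subset _ _)
  by_contra! hcon
  have h1 : ∑ u ∈ balancedPairs ι w l, ((U.filter fun s => Covers u s).card : ℝ) <
      ∑ u ∈ balancedPairs ι w l, ((2 * l).choose l / (Fintype.card ι).choose w : ℝ) * U.card :=
    Finset.sum_lt_sum_of_nonempty hne fun u hu =>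
      hcon u (mem_balancedPairs.1 hu).1
  rw [← Nat.cast_sum, hcount U hU, Finset.sum_const, nsmul_eq_mul] at h1
  have h2 : ((balancedPairs ι w l).card : ℝ) * (2 * l).choose l ≤
      (Fintype.card ι).choose w * d := by exact_mod_cast htotal
  have hC' : (0 : ℝ) < (Fintype.card ι).choose w := by exact_mod_cast hC
  have h3 : ((balancedPairs ι w l).card : ℝ) *
      ((2 * l).choose l / (Fintype.card ι).choose w) ≤ d := by
    rw [← mul_div_assoc, div_le_iff₀ hC']
    linarith
  have h4 := mul_le_mul_of_nonneg_right h3 (Nat.cast_nonneg (α := ℝ) U.card)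
  push_cast at h1
  linarith

-- Adding the pair from `exists_covers_many` to the cover removes at least the fraction θ of what is
-- still uncovered.
open Classical in
theorem exists_greedy_cover {w l : ℕ} (hlw : l ≤ w) (hlw' : l ≤ Fintype.card ι - w)
    (hw : w ≤ Fintype.card ι) (t : ℕ) :
    ∃ 𝒞 : Finset (Finset ι × Finset ι), 𝒞.card ≤ t ∧ (∀ u ∈ 𝒞, u.1.card = 2 * l) ∧
      (((Finset.powersetCard w (Finset.univ : Finset ι)).filter
          fun s => ∀ u ∈ 𝒞, ¬ Covers u s).card : ℝ) ≤
        (1 - (2 * l).choose l / (Fintype.card ι).choose w : ℝ) ^ t *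
          (Fintype.card ι).choose w := by
  induction t with
  | zero => exact ⟨∅, by simp, by simp, by simp [Finset.card_univ]⟩
  | succ t ih =>
    obtain ⟨𝒞, h1, h2, h3⟩ := ih
    set θ : ℝ := (2 * l).choose l / (Fintype.card ι).choose w with hθ
    set U := (Finset.powersetCard w (Finset.univ : Finset ι)).filter
      fun s => ∀ u ∈ 𝒞, ¬ Covers u s with hUdef
    have hU : ∀ s ∈ U, s.card = w :=
      fun s hs => (Finset.mem_powersetCard.1 (Finset.mem_filter.1 hs).1).2
    obtain ⟨u, hu, hcov⟩ := exists_covers_many hlw hlw' hw U hU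
    rw [← hθ] at hcov
    refine ⟨insert u 𝒞, (Finset.card_insert_le _ _).trans (by omega), ?_, ?_⟩
    · intro v hv
      rcases Finset.mem_insert.1 hv with rfl | hv
      · exact hu
      · exact h2 v hv
    · have h4 : (Finset.powersetCard w (Finset.univ : Finset ι)).filter
          (fun s => ∀ v ∈ insert u 𝒞, ¬ Covers v s) = U.filter fun s => ¬ Covers u s := by
        rw [hUdef, Finset.filter_filter]
        refine Finset.filter_congr fun s _ => ?_
        rw [Finset.forall_mem_insert, and_comm]
      have h5 := Finset.card_filter_add_card_filter_not (s := U) fun s => Covers u s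
      have h6 : ((U.filter fun s => Covers u s).card : ℝ) +
          (U.filter fun s => ¬ Covers u s).card = U.card := by exact_mod_cast h5
      rw [h4, pow_succ]
      -- A balanced pair exists, and the sets it covers are among all the `w`-sets.
      have h8 : θ ≤ 1 := by
        by_contra! h8
        have h9 : ((2 * l).choose l : ℝ) ≤ (Fintype.card ι).choose w := by
          obtain ⟨s, -, hs⟩ := Finset.exists_subset_card_eq (s := (Finset.univ : Finset ι))
            (n := w) (by rwa [Finset.card_univ])
          have a1 := card_balancedPairs_filter hlw hs
          have a2 : 0 < w.choose l * (Fintype.card ι - w).choose l :=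
            Nat.mul_pos (Nat.choose_pos hlw) (Nat.choose_pos hlw')
          obtain ⟨v, hv⟩ := Finset.card_pos.1 (a1 ▸ a2)
          have a3 := choose_le_card_filter_covers hlw (Finset.mem_filter.1 hv).1
          have a4 := a3.trans (Finset.card_le_card (Finset.filter_subset _ _))
          rw [Finset.card_powersetCard, Finset.card_univ] at a4
          exact_mod_cast a4
        have h10 : (0 : ℝ) < (Fintype.card ι).choose w := by exact_mod_cast Nat.choose_pos hw
        rw [hθ, lt_div_iff₀ h10] at h8
        linarith
      have h7 : ((U.filter fun s => ¬ Covers u s).card : ℝ) ≤ (1 - θ) * U.card := by linarith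
      have h9 := mul_le_mul_of_nonneg_left h3 (sub_nonneg.2 h8)
      linarith

/-- Economical covers of the sets of size `w`. -/
theorem exists_cover_slice {w l : ℕ} (hlw : l ≤ w) (hlw' : l ≤ Fintype.card ι - w)
    (hw : w ≤ Fintype.card ι) :
    ∃ 𝒞 : Finset (Finset ι × Finset ι),
      (𝒞.card : ℝ) ≤ Fintype.card ι * ((Fintype.card ι).choose w / (2 * l).choose l) + 1 ∧
      (∀ u ∈ 𝒞, u.1.card = 2 * l) ∧
      ∀ s : Finset ι, s.card = w → ∃ u ∈ 𝒞, Covers u s := by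
  classical
  set n := Fintype.card ι
  have hC : (0 : ℝ) < n.choose w := by exact_mod_cast Nat.choose_pos hw
  have hB : (0 : ℝ) < (2 * l).choose l := by exact_mod_cast Nat.choose_pos (by omega)
  set θ : ℝ := (2 * l).choose l / n.choose w with hθ
  have hθ0 : 0 < θ := div_pos hB hC
  have hinv : (n.choose w / (2 * l).choose l : ℝ) = θ⁻¹ := by rw [hθ, inv_div]
  -- With more than n/θ steps, fewer than exp(-n) · exp(n) = 1 sets remain uncovered, hence none.
  obtain ⟨𝒞, h1, h2, h3⟩ := exists_greedy_cover hlw hlw' hw (⌊(n : ℝ) * θ⁻¹⌋₊ + 1)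
  refine ⟨𝒞, ?_, h2, ?_⟩
  · rw [hinv]
    calc (𝒞.card : ℝ) ≤ (⌊(n : ℝ) * θ⁻¹⌋₊ + 1 : ℕ) := by exact_mod_cast h1
      _ ≤ _ := by
        push_cast
        gcongr
        exact Nat.floor_le (by positivity)
  · intro s hs
    by_contra! hcon
    have h4 : 1 ≤ (((Finset.powersetCard w (Finset.univ : Finset ι)).filter
          fun s => ∀ u ∈ 𝒞, ¬ Covers u s).card : ℝ) := by
      exact_mod_cast Finset.card_pos.2 ⟨s, Finset.mem_filter.2
        ⟨Finset.mem_powersetCard.2 ⟨Finset.subset_univ _, hs⟩, hcon⟩⟩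
    have h5 : (n : ℝ) < (⌊(n : ℝ) * θ⁻¹⌋₊ + 1 : ℕ) * θ := by
      rw [← div_lt_iff₀ hθ0, div_eq_mul_inv]
      push_cast
      exact Nat.lt_floor_add_one _
    have h6 : (n.choose w : ℝ) ≤ Real.exp n := by
      calc (n.choose w : ℝ) ≤ (2 : ℝ) ^ n := by exact_mod_cast Nat.choose_le_two_pow n w
        _ ≤ (Real.exp 1) ^ n := by
          gcongr
          have := Real.add_one_le_exp 1
          linarith
        _ = Real.exp n := by rw [← Real.exp_nat_mul, mul_one]
    have h7 : (1 - θ) ^ (⌊(n : ℝ) * θ⁻¹⌋₊ + 1) ≤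
        Real.exp (-((⌊(n : ℝ) * θ⁻¹⌋₊ + 1 : ℕ) * θ)) := by
      by_cases h : 0 ≤ 1 - θ
      · calc _ ≤ (Real.exp (-θ)) ^ (⌊(n : ℝ) * θ⁻¹⌋₊ + 1) := by
              gcongr
              have := Real.add_one_le_exp (-θ)
              linarith
          _ = _ := by
              rw [← Real.exp_nat_mul]
              congr 1
              ring
      -- If 1 - θ were negative, the bound after one greedy step would make a cardinality negative.
      · exfalso
        obtain ⟨𝒟, -, -, h8⟩ := exists_greedy_cover (ι := ι) hlw hlw' hw 1
        rw [pow_one, ← hθ] at h8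
        have h9 : (1 - θ) * n.choose w < 0 := mul_neg_of_neg_of_pos (not_le.1 h) hC
        have h10 := (Nat.cast_nonneg _).trans h8
        linarith
    have h8 : (1 - θ) ^ (⌊(n : ℝ) * θ⁻¹⌋₊ + 1) * n.choose w < 1 := by
      calc _ ≤ Real.exp (-((⌊(n : ℝ) * θ⁻¹⌋₊ + 1 : ℕ) * θ)) * Real.exp n := by gcongr
        _ = Real.exp (n - (⌊(n : ℝ) * θ⁻¹⌋₊ + 1 : ℕ) * θ) := by
          rw [← Real.exp_add]
          congr 1
          ring
        _ < 1 := by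
          rw [Real.exp_lt_one_iff]
          linarith
    linarith

/-- The indicators of the `w`-sets are typical sequences. -/
theorem choose_le_exp_of_typical {p a : ℝ} (hp0 : 0 < p) (hp : p < 1 / 2) {w : ℕ}
    (hw : |(w : ℝ) - Fintype.card ι * p| ≤ a) :
    ((Fintype.card ι).choose w : ℝ) ≤
      Real.exp (Fintype.card ι * Real.binEntropy p + a * logRatio p) := by
  classical
  have hones : ∀ s : Finset ι, ones (fun j => decide (j ∈ s)) = s := fun s => by
    ext j; simp [ones]
  have h1 := card_le_exp_of_subset_typical hp0 hp (ι := ι) (a := a)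
    (s := (Finset.powersetCard w Finset.univ).image fun s j => decide (j ∈ s)) (by
      intro x hx
      obtain ⟨s, hs, rfl⟩ := Finset.mem_image.1 hx
      simp only [typical, Finset.mem_filter, Finset.mem_univ, true_and, hones,
        (Finset.mem_powersetCard.1 hs).2]
      exact hw)
  rw [Finset.card_image_of_injective, Finset.card_powersetCard, Finset.card_univ] at h1
  · exact h1
  · intro s t hst
    rw [← hones s, ← hones t]
    exact congrArg ones hst

theorem four_pow_le_mul_choose (l : ℕ) : 4 ^ l ≤ (2 * l + 1) * (2 * l).choose l := by
  rcases Nat.eq_zero_or_pos l with rfl | hl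
  · simp
  · have h := Nat.four_pow_le_two_mul_self_mul_centralBinom l hl
    rw [Nat.centralBinom_eq_two_mul_choose] at h
    exact h.trans (Nat.mul_le_mul_right _ (by omega))

/-- Economical covers of the typical sequences by cubes of dimension `2 * l`. -/
theorem exists_cover_typical {p a : ℝ} (hp0 : 0 < p) (hp : p < 1 / 2) {l : ℕ}
    (hl : ∀ w : ℕ, w ≤ Fintype.card ι → |(w : ℝ) - Fintype.card ι * p| ≤ a →
      l ≤ w ∧ l ≤ Fintype.card ι - w) :
    ∃ 𝒞 : Finset (Finset ι × Finset ι),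
      (𝒞.card : ℝ) * 4 ^ l ≤ (Fintype.card ι + 1) * (Fintype.card ι * (2 * l + 1) *
        Real.exp (Fintype.card ι * Real.binEntropy p + a * logRatio p) + 4 ^ l) ∧
      (∀ u ∈ 𝒞, u.1.card = 2 * l) ∧
      ∀ x ∈ typical ι p a, ∃ u ∈ 𝒞, x ∈ cube u := by
  classical
  set n := Fintype.card ι
  have h := fun (w : ℕ) (h : w ≤ n ∧ |(w : ℝ) - n * p| ≤ a) =>
    exists_cover_slice (ι := ι) (hl w h.1 h.2).1 (hl w h.1 h.2).2 h.1
  choose 𝒞 hcard hdim hcov using h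
  -- One cover for each typical weight; their union costs a factor n + 1.
  let 𝒟 : ℕ → Finset (Finset ι × Finset ι) := fun w =>
    if h : w ≤ n ∧ |(w : ℝ) - n * p| ≤ a then 𝒞 w h else ∅
  have hB : (0 : ℝ) < (2 * l).choose l := by exact_mod_cast Nat.choose_pos (by omega)
  have h4 : (4 : ℝ) ^ l ≤ (2 * l + 1) * (2 * l).choose l := by
    exact_mod_cast four_pow_le_mul_choose l
  refine ⟨(Finset.range (n + 1)).biUnion 𝒟, ?_, ?_, ?_⟩
  · have h1 : ∀ w, ((𝒟 w).card : ℝ) * 4 ^ l ≤ n * (2 * l + 1) *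
        Real.exp (n * Real.binEntropy p + a * logRatio p) + 4 ^ l := by
      intro w
      by_cases hw : w ≤ n ∧ |(w : ℝ) - n * p| ≤ a
      · simp only [𝒟, hw, and_self, dif_pos]
        calc _ ≤ (n * (n.choose w / (2 * l).choose l) + 1) * (4 : ℝ) ^ l := by
              gcongr
              exact hcard w hw
          _ = n * n.choose w * (4 ^ l / (2 * l).choose l) + 4 ^ l := by ring
          _ ≤ n * Real.exp (n * Real.binEntropy p + a * logRatio p) * (2 * l + 1) + 4 ^ l := by
              gcongr
              · exact choose_le_exp_of_typical hp0 hp hw.2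
              · rwa [div_le_iff₀ hB]
          _ = _ := by ring
      · simp only [𝒟, hw, dif_neg, not_false_eq_true, Finset.card_empty]
        rw [Nat.cast_zero, zero_mul]
        positivity
    calc _ ≤ (∑ w ∈ Finset.range (n + 1), ((𝒟 w).card : ℝ)) * 4 ^ l := by
          gcongr
          exact_mod_cast Finset.card_biUnion_le
      _ ≤ ∑ w ∈ Finset.range (n + 1), (n * (2 * l + 1) *
          Real.exp (n * Real.binEntropy p + a * logRatio p) + 4 ^ l) := by
          rw [Finset.sum_mul]
          exact Finset.sum_le_sum fun w _ => h1 w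
      _ = _ := by
          rw [Finset.sum_const, Finset.card_range, nsmul_eq_mul]
          push_cast
          ring
  · intro u hu
    obtain ⟨w, -, hu⟩ := Finset.mem_biUnion.1 hu
    by_cases hw : w ≤ n ∧ |(w : ℝ) - n * p| ≤ a
    · simp only [𝒟, hw, and_self, dif_pos] at hu
      exact hdim w hw u hu
    · simp [𝒟, hw] at hu
  · intro x hx
    have hw : (ones x).card ≤ n ∧ |((ones x).card : ℝ) - n * p| ≤ a :=
      ⟨Finset.card_le_univ _, by simpa [typical] using hx⟩
    obtain ⟨u, hu, huc⟩ := hcov _ hw (ones x) rfl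
    refine ⟨u, Finset.mem_biUnion.2 ⟨(ones x).card, by simp [hw.1], ?_⟩,
      huc.mem_cube⟩
    simp only [𝒟, hw, and_self, dif_pos]
    exact hu

end Cubes

/-! ### Cube codes and the exponential moment of the number of mistakes -/

namespace Code

variable {n K M : ℕ}

/-- The positions in `E` at which a causal predictor errs. -/
def mistakes (E : Finset (Fin n)) (z : ∀ q : Fin n, (Fin q.val → Bool) → Bool)
    (x : Fin n → Bool) : Finset (Fin n) :=
  E.filter fun q => x q ≠ z q (past x q)

/-- The sequence can be rebuilt from left to right: at a free position the past gives the prediction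
and the mistake set tells whether to flip it; elsewhere the cube gives the bit. -/
theorem injOn_mistakes (u : Finset (Fin n) × Finset (Fin n))
    (z : ∀ q : Fin n, (Fin q.val → Bool) → Bool) : Set.InjOn (mistakes u.1 z) (cube u) := by
  intro x hx y hy hxy
  have key : ∀ k : ℕ, ∀ q : Fin n, q.val = k → x q = y q := by
    intro k
    induction k using Nat.strong_induction_on with
    | _ k ih =>
      intro q hq
      have hpast : past x q = past y q :=
        past_eq_iff.2 fun j hj => ih j.val (by omega) j rfl
      rw [Bool.eq_iff_iff]
      by_cases hE : q ∈ u.1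
      · have := Finset.ext_iff.1 hxy q
        simp only [mistakes, Finset.mem_filter, hE, true_and, hpast] at this
        revert this
        generalize z q (past y q) = b
        cases x q <;> cases y q <;> cases b <;> simp
      · rw [mem_cube.1 hx q hE, mem_cube.1 hy q hE]
  exact funext fun q => key q.val q rfl

/-- By injectivity the sum is at most the one over all subsets of the free positions, which is the
binomial theorem. -/
theorem sum_cube_pow_mistakes_le (u : Finset (Fin n) × Finset (Fin n))
    (z : ∀ q : Fin n, (Fin q.val → Bool) → Bool) {t : ℝ} (ht : 0 ≤ t) :
    ∑ x ∈ cube u, t ^ (mistakes u.1 z x).card ≤ (1 + t) ^ u.1.card := by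
  have h := Finset.sum_pow_mul_eq_add_pow t 1 u.1
  simp only [one_pow, mul_one] at h
  rw [add_comm, ← h, ← Finset.sum_image (f := fun y : Finset (Fin n) => t ^ y.card)
    (injOn_mistakes u z)]
  refine Finset.sum_le_sum_of_subset_of_nonneg (fun y hy => ?_) fun _ _ _ => by positivity
  obtain ⟨x, -, rfl⟩ := Finset.mem_image.1 hy
  exact Finset.mem_powerset.2 (Finset.filter_subset _ _)

/-- Reducing the key modulo `L` is uniform up to a factor 2, even when `L` does not divide `K`. -/
theorem card_filter_mod_le {L : ℕ} [NeZero L] (hL : L ≤ K) (b : Fin L) :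
    ((Finset.univ.filter fun ω : Fin K => Fin.ofNat L ω.val = b).card : ℝ) ≤ 2 * K / L := by
  have hLpos : 0 < L := Nat.pos_of_ne_zero (NeZero.ne L)
  have h1 : (Finset.univ.filter fun ω : Fin K => Fin.ofNat L ω.val = b).card ≤ K / L + 1 := by
    rw [← Finset.card_range (K / L + 1)]
    refine Finset.card_le_card_of_injOn (fun ω => ω.val / L) ?_ ?_
    · intro ω _
      rw [Finset.mem_coe, Finset.mem_range, Nat.lt_succ_iff]
      exact Nat.div_le_div_right ω.isLt.le
    · intro ω hω ω' hω' h
      have h2 : ω.val % L = b.val := by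
        have := (Finset.mem_filter.1 (Finset.mem_coe.1 hω)).2
        rw [← this]; rfl
      have h3 : ω'.val % L = b.val := by
        have := (Finset.mem_filter.1 (Finset.mem_coe.1 hω')).2
        rw [← this]; rfl
      have h4 := Nat.div_add_mod ω.val L
      have h5 := Nat.div_add_mod ω'.val L
      simp only at h
      rw [h2, h] at h4
      rw [h3] at h5
      exact Fin.ext (h4.symm.trans h5)
  have hL' : (0 : ℝ) < L := by exact_mod_cast hLpos
  rw [le_div_iff₀ hL']
  have h2 : (K / L + 1) * L ≤ 2 * K := by
    have := Nat.div_mul_le_self K L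
    linarith
  calc _ ≤ ((K / L + 1 : ℕ) : ℝ) * L := by gcongr
    _ ≤ _ := by exact_mod_cast h2

/-- The Chernoff exponent for fewer than (1 - 2η)l successes in 2l fair trials, from cosh(2η) ≤
exp(2η²). -/
theorem exp_mul_one_add_exp_le (η : ℝ) (l : ℕ) :
    Real.exp (4 * η * ((1 - 2 * η) * l)) * (1 + Real.exp (-(4 * η))) ^ (2 * l) ≤
      4 ^ l * Real.exp (-(4 * η ^ 2 * l)) := by
  have h1 : 1 + Real.exp (-(4 * η)) = 2 * Real.exp (-(2 * η)) * Real.cosh (2 * η) := by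
    rw [Real.cosh_eq]
    have : Real.exp (-(4 * η)) = Real.exp (-(2 * η)) * Real.exp (-(2 * η)) := by
      rw [← Real.exp_add]; ring_nf
    have h2 : Real.exp (-(2 * η)) * Real.exp (2 * η) = 1 := by
      rw [← Real.exp_add]; simp
    rw [this]
    linear_combination -h2
  have h2 : (1 + Real.exp (-(4 * η))) ^ (2 * l) ≤
      (2 * Real.exp (-(2 * η)) * Real.exp ((2 * η) ^ 2 / 2)) ^ (2 * l) := by
    rw [h1]
    gcongr
    exact Real.cosh_le_exp_half_sq _
  refine (mul_le_mul_of_nonneg_left h2 (Real.exp_pos _).le).trans (le_of_eq ?_)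
  rw [mul_assoc 2, ← Real.exp_add, mul_pow, ← Real.exp_nat_mul, pow_mul, mul_left_comm,
    ← Real.exp_add]
  norm_num
  ring

/-- The pointwise bound behind the exponential moment estimate of the number `k` of mistakes. -/
theorem mul_one_sub_exp_le {r s k : ℝ} (hr : 0 ≤ r) (hs : 0 ≤ s) (hk : 0 ≤ k) :
    r * (1 - Real.exp (s * r) * Real.exp (-s * k)) ≤ k := by
  rw [← Real.exp_add]
  have h := Real.exp_pos (s * r + -s * k)
  rcases le_total r k with h1 | h1
  · nlinarith
  · have h2 : 1 ≤ Real.exp (s * r + -s * k) := Real.one_le_exp (by nlinarith)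
    nlinarith

/-- The code that reveals which cube of a cover the source sequence lies in, and hides the
position in the cube. -/
theorem exists_cube_code {p a : ℝ} (hp0 : 0 < p) (hp : p < 1 / 2) {l : ℕ}
    (𝒞 : Finset (Finset (Fin n) × Finset (Fin n))) (hdim : ∀ u ∈ 𝒞, u.1.card = 2 * l)
    (hcov : ∀ x ∈ typical (Fin n) p a, ∃ u ∈ 𝒞, x ∈ cube u) (hne : 1 ≤ 𝒞.card)
    (hK : 4 ^ l ≤ K) (hM : 𝒞.card * 4 ^ l ≤ M) :
    ∃ c : Code Bool n K M, c.IsDeterministic ∧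
      ∑ x ∈ typical (Fin n) p a, seqProb p x ≤ c.successProb (bernoulli p) ∧
      ∀ η : ℝ, 0 ≤ η → η ≤ 1 / 2 →
        (n : ℝ)⁻¹ * ((1 - 2 * η) * l * (∑ x ∈ typical (Fin n) p a, seqProb p x -
          2 * (𝒞.card * 4 ^ l) * Real.exp (-(4 * η ^ 2 * l)) *
            Real.exp (-(n * Real.binEntropy p) + a * logRatio p))) ≤
        c.forcedDistortion (bernoulli p) hamming := by
  classical
  have hK1 : 1 ≤ K := (Nat.one_le_pow _ _ (by norm_num)).trans hK
  have hK' : (0 : ℝ) < K := by exact_mod_cast hK1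
  set L := 4 ^ l with hL
  have hLne : NeZero L := ⟨by positivity⟩
  set N := 𝒞.card with hN
  let C : Fin N → Finset (Fin n) × Finset (Fin n) := fun k => (𝒞.equivFin.symm k).1
  have hC : ∀ k, C k ∈ 𝒞 := fun k => (𝒞.equivFin.symm k).2
  -- Outside the typical set the cube is arbitrary: success is claimed only for typical sequences.
  have hcov' : ∀ x, ∃ k : Fin N, x ∈ typical (Fin n) p a → x ∈ cube (C k) := by
    intro x
    by_cases hx : x ∈ typical (Fin n) p a
    · obtain ⟨u, hu, hxu⟩ := hcov x hx
      exact ⟨𝒞.equivFin ⟨u, hu⟩, fun _ => by simpa [C] using hxu⟩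
    · exact ⟨⟨0, hne⟩, fun h => absurd h hx⟩
  choose φ hφ using hcov'
  have hψ : ∀ k, ∃ f : (Fin n → Bool) → Fin L, Set.InjOn f (cube (C k)) := fun k =>
    exists_injOn_fin _ (Nat.one_le_pow _ _ (by norm_num)) ((card_cube_le _).trans (by
      rw [hdim _ (hC k), pow_mul, hL]; norm_num))
  choose ψ hψ using hψ
  let f : (Fin n → Bool) → Fin K → Fin M := fun x ω =>
    pairEmb hM (φ x, ψ (φ x) x + Fin.ofNat L ω.val)
  have hf : ∀ ω, Set.InjOn (fun x => f x ω) (typical (Fin n) p a) := by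
    intro ω x hx y hy hxy
    have h := (pairEmb hM).injective hxy
    simp only [Prod.mk.injEq] at h
    obtain ⟨h1, h2⟩ := h
    rw [← h1] at h2
    have hy' := hφ y hy
    rw [← h1] at hy'
    exact hψ _ (hφ x hx) hy' (add_right_cancel h2)
  obtain ⟨c, hc, hjoint, hsucc⟩ := exists_code hK1 f _ hf
  refine ⟨c, hc, hsucc p hp0 hp, fun η hη0 hη => ?_⟩
  obtain ⟨z, hz⟩ := c.exists_forcedDistortion_eq p
  rw [hz]
  refine mul_le_mul_of_nonneg_left ?_ (by positivity)
  set T := typical (Fin n) p a with hT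
  set r : ℝ := (1 - 2 * η) * l with hr
  have hr0 : 0 ≤ r := mul_nonneg (by linarith) (Nat.cast_nonneg _)
  set t : ℝ := Real.exp (-(4 * η)) with ht
  -- Only mistakes at the free positions of the announced cube are counted.
  let k : (Fin n → Bool) → Fin M → ℕ := fun x i =>
    (mistakes (C (pairFst hM hne i)).1 (fun q => z q i) x).card
  have hk : ∀ x i, (k x i : ℝ) ≤ ∑ q, hamming (x q) (z q i (past x q)) := by
    intro x i
    simp only [k, mistakes, Finset.card_filter, Nat.cast_sum]
    refine (Finset.sum_le_sum fun q _ => ?_).trans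
      (Finset.sum_le_univ_sum_of_nonneg fun q => hamming_nonneg _ _)
    unfold hamming
    split_ifs <;> simp_all
  have hpow : ∀ j : ℕ, Real.exp (-(4 * η) * j) = t ^ j := fun j => by
    rw [ht, ← Real.exp_nat_mul, mul_comm]
  -- Apply `mul_one_sub_exp_le` to the number of mistakes and average: it remains to bound an
  -- exponential moment.
  have h1 : r * (∑ x ∈ T, seqProb p x - Real.exp (4 * η * r) *
      ∑ i, ∑ x ∈ T, c.jointProb (bernoulli p) x i * t ^ k x i) ≤
      ∑ q, c.expectedDistortion (bernoulli p) hamming q (z q) := by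
    calc _ = ∑ x ∈ T, ∑ i, c.jointProb (bernoulli p) x i *
          (r * (1 - Real.exp (4 * η * r) * Real.exp (-(4 * η) * k x i))) := by
          simp only [hpow, mul_sub, mul_one, Finset.sum_sub_distrib]
          rw [Finset.sum_comm (s := Finset.univ), Finset.mul_sum, Finset.mul_sum, Finset.mul_sum]
          congr 1
          · refine Finset.sum_congr rfl fun x _ => ?_
            rw [← Finset.sum_mul, c.sum_jointProb hK1, mul_comm]
          · refine Finset.sum_congr rfl fun x _ => ?_
            rw [Finset.mul_sum, Finset.mul_sum]
            refine Finset.sum_congr rfl fun i _ => ?_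
            ring
      _ ≤ ∑ x ∈ T, ∑ i, c.jointProb (bernoulli p) x i *
          ∑ q, hamming (x q) (z q i (past x q)) := by
          refine Finset.sum_le_sum fun x _ => Finset.sum_le_sum fun i _ =>
            mul_le_mul_of_nonneg_left ?_ (c.jointProb_nonneg hp0 hp x i)
          exact (mul_one_sub_exp_le hr0 (by linarith) (Nat.cast_nonneg _)).trans (hk x i)
      _ ≤ ∑ x, ∑ i, c.jointProb (bernoulli p) x i *
          ∑ q, hamming (x q) (z q i (past x q)) :=
          Finset.sum_le_univ_sum_of_nonneg fun x => Finset.sum_nonneg fun i _ =>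
            mul_nonneg (c.jointProb_nonneg hp0 hp x i)
              (Finset.sum_nonneg fun q _ => hamming_nonneg _ _)
      _ = _ := by
          simp only [expectedDistortion]
          refine Eq.trans ?_ Finset.sum_comm
          refine Finset.sum_congr rfl fun x _ => ?_
          rw [Finset.sum_comm]
          exact Finset.sum_congr rfl fun i _ => Finset.mul_sum _ _ _
  refine le_trans (mul_le_mul_of_nonneg_left (sub_le_sub_left ?_ _) hr0) h1
  set E := Real.exp (-(n * Real.binEntropy p) + a * logRatio p) with hE
  have hj0 : ∀ i, i ∉ Finset.univ.map (pairEmb hM) → ∀ x, c.jointProb (bernoulli p) x i = 0 := by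
    intro i hi x
    rw [hjoint, Finset.filter_eq_empty_iff.2]
    · simp
    · intro ω _ hω
      exact hi (Finset.mem_map.2 ⟨_, Finset.mem_univ _, hω⟩)
  -- A message is a cube with a padded index. Only sequences assigned to that cube contribute, each
  -- with weight at most `E * (2 / L)`, and the rest is the binomial sum.
  have h2 : ∀ b : Fin N × Fin L, ∑ x ∈ T, c.jointProb (bernoulli p) x (pairEmb hM b) *
      t ^ k x (pairEmb hM b) ≤ E * (2 / L) * (1 + t) ^ (2 * l) := by
    intro b
    have hle : ∀ x ∈ T, c.jointProb (bernoulli p) x (pairEmb hM b) ≤ E * (2 / L) := by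
      intro x hx
      rw [hjoint]
      have hEx := seqProb_le_of_mem_typical hp0 hp hx
      rw [Fintype.card_fin] at hEx
      refine mul_le_mul hEx ?_ (by positivity) (Real.exp_pos _).le
      rw [mul_inv_le_iff₀ hK']
      calc _ ≤ ((Finset.univ.filter fun ω : Fin K =>
            Fin.ofNat L ω.val = b.2 - ψ (φ x) x).card : ℝ) := by
            norm_cast
            refine Finset.card_le_card fun ω hω => ?_
            have h := (pairEmb hM).injective (Finset.mem_filter.1 hω).2
            refine Finset.mem_filter.2 ⟨Finset.mem_univ _, ?_⟩
            rw [← h]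
            simp
        _ ≤ 2 * K / L := card_filter_mod_le hK _
        _ = _ := by ring
    calc _ ≤ ∑ x ∈ T.filter (fun x => φ x = b.1), E * (2 / L) * t ^ k x (pairEmb hM b) := by
          rw [Finset.sum_filter]
          refine Finset.sum_le_sum fun x hx => ?_
          split_ifs with hxb
          · exact mul_le_mul_of_nonneg_right (hle x hx) (by positivity)
          · rw [hjoint, Finset.filter_eq_empty_iff.2]
            · simp
            · intro ω _ hω
              exact hxb (congrArg Prod.fst ((pairEmb hM).injective hω))
      _ ≤ ∑ x ∈ cube (C b.1), E * (2 / L) * t ^ k x (pairEmb hM b) := by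
          refine Finset.sum_le_sum_of_subset_of_nonneg (fun x hx => ?_)
            fun _ _ _ => by positivity
          obtain ⟨hxT, hxb⟩ := Finset.mem_filter.1 hx
          rw [← hxb]
          exact hφ x hxT
      _ ≤ _ := by
          rw [← Finset.mul_sum]
          refine mul_le_mul_of_nonneg_left ?_ (by positivity)
          simp only [k, pairFst_pairEmb]
          rw [← hdim _ (hC b.1)]
          exact sum_cube_pow_mistakes_le (C b.1) (fun q => z q (pairEmb hM b))
            (Real.exp_pos _).le
  have h3 : ∑ i, ∑ x ∈ T, c.jointProb (bernoulli p) x i * t ^ k x i ≤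
      N * L * (E * (2 / L) * (1 + t) ^ (2 * l)) := by
    rw [← Finset.sum_subset (Finset.subset_univ (Finset.univ.map (pairEmb hM)))
      fun i _ hi => Finset.sum_eq_zero fun x _ => by rw [hj0 i hi x, zero_mul],
      Finset.sum_map]
    refine (Finset.sum_le_sum fun b _ => h2 b).trans (le_of_eq ?_)
    simp
  have hL0 : (L : ℝ) ≠ 0 := by positivity
  calc _ ≤ Real.exp (4 * η * r) * (N * L * (E * (2 / L) * (1 + t) ^ (2 * l))) := by gcongr
    _ = 2 * N * E * (Real.exp (4 * η * r) * (1 + t) ^ (2 * l)) := by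
        field_simp
    _ ≤ 2 * N * E * (4 ^ l * Real.exp (-(4 * η ^ 2 * l))) := by
        exact mul_le_mul_of_nonneg_left (exp_mul_one_add_exp_le η l) (by positivity)
    _ = _ := by ring

end Code

/-! ### Rates in natural units -/

theorem two_rpow_eq_exp (n : ℕ) (R : ℝ) :
    (2 : ℝ) ^ ((n : ℝ) * R) = Real.exp (n * (R * Real.log 2)) := by
  rw [Real.rpow_def_of_pos (by norm_num)]
  ring_nf

theorem numValues_le_exp (n : ℕ) (R : ℝ) :
    (numValues n R : ℝ) ≤ Real.exp (n * (R * Real.log 2)) := by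
  rw [← two_rpow_eq_exp]
  exact Nat.floor_le (by positivity)

theorem le_numValues {n k : ℕ} {R : ℝ} (h : (k : ℝ) ≤ Real.exp (n * (R * Real.log 2))) :
    k ≤ numValues n R := by
  rw [← two_rpow_eq_exp] at h
  exact Nat.le_floor h

theorem one_le_numValues (n : ℕ) {R : ℝ} (hR : 0 ≤ R) : 1 ≤ numValues n R :=
  le_numValues (by
    rw [Nat.cast_one]
    exact Real.one_le_exp (mul_nonneg (Nat.cast_nonneg _)
      (mul_nonneg hR (Real.log_nonneg (by norm_num)))))

theorem binaryEntropy_mul_log (p : ℝ) : binaryEntropy p * Real.log 2 = Real.binEntropy p :=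
  div_mul_cancel₀ _ (Real.log_pos (by norm_num)).ne'

theorem binEntropy_pos' {p : ℝ} (hp0 : 0 < p) (hp : p < 1 / 2) : 0 < Real.binEntropy p :=
  Real.binEntropy_pos hp0 (by linarith)

theorem binaryEntropy_pos {p : ℝ} (hp0 : 0 < p) (hp : p < 1 / 2) : 0 < binaryEntropy p :=
  div_pos (binEntropy_pos' hp0 hp) (Real.log_pos (by norm_num))

theorem Code.IsDeterministic.inClass {n K M : ℕ} {c : Code Bool n K M} (h : c.IsDeterministic)
    (k : CodeClass) : c.InClass k := by
  cases k
  · exact h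
  · trivial

theorem successProb_eq_zero {n M : ℕ} (c : Code Bool n 0 M) (p : ℝ) :
    c.successProb (bernoulli p) = 0 := by
  simp [Code.successProb]

/-! ### Converse bounds in the limit -/

section Converse

variable {p R₀ R : ℝ} {c : ∀ n : ℕ, Code Bool n (numValues n R₀) (numValues n R)}

/-- A negative key rate would leave no key values, and then the success probability is 0. -/
theorem eventually_one_le_numValues
    (hc : Tendsto (fun n => (c n).successProb (bernoulli p)) atTop (𝓝 1)) :
    ∀ᶠ n in atTop, 1 ≤ numValues n R₀ := by
  filter_upwards [hc.eventually (lt_mem_nhds (show (0 : ℝ) < 1 by norm_num))] with n hn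
  by_contra! h
  have h0 : numValues n R₀ = 0 := by omega
  have : ∀ (K : ℕ) (c : Code Bool n K (numValues n R)), K = 0 →
      c.successProb (bernoulli p) = 0 := by
    rintro K c rfl
    exact successProb_eq_zero c p
  rw [this _ _ h0] at hn
  exact lt_irrefl _ hn

theorem tendsto_one_sub {f : ℕ → ℝ} (hf : Tendsto f atTop (𝓝 1)) (a : ℝ) :
    Tendsto (fun n => a + (1 - f n)) atTop (𝓝 a) := by
  have := (hf.const_sub 1).const_add a
  simpa using this

/-- The distortion that can be forced is at most half the key rate, and at most `p`. -/
theorem CanForce.le {k : CodeClass} {D : ℝ} (hp0 : 0 < p) (hp : p < 1 / 2)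
    (h : CanForce k (bernoulli p) hamming R₀ R D) : D ≤ min (R₀ / 2) p := by
  obtain ⟨c, -, hc, hD⟩ := h
  have hK := eventually_one_le_numValues hc
  refine le_min ?_ ?_
  · refine ge_of_tendsto (tendsto_one_sub hc (R₀ / 2)) ?_
    filter_upwards [hK, eventually_ge_atTop 1] with n hKn hn
    refine (hD n hn).trans (((c n).forcedDistortion_le_log hn hKn hp0 hp).trans ?_)
    gcongr
    have hlog2 : 0 < Real.log 2 := Real.log_pos (by norm_num)
    have hlog4 : Real.log 4 = 2 * Real.log 2 := by
      rw [show (4 : ℝ) = 2 ^ 2 by norm_num, Real.log_pow]; norm_num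
    have hlogK : Real.log (numValues n R₀) ≤ n * (R₀ * Real.log 2) := by
      rw [Real.log_le_iff_le_exp (by exact_mod_cast hKn)]
      exact numValues_le_exp n R₀
    have hn' : (0 : ℝ) < n := by exact_mod_cast hn
    rw [hlog4, inv_mul_le_iff₀ hn', div_le_iff₀ (by positivity)]
    linarith
  · obtain ⟨n, hKn, hn⟩ := (hK.and (eventually_ge_atTop 1)).exists
    exact (hD n hn).trans ((c n).forcedDistortion_le_self hKn hp0)

/-- A hidden prefix uses up key at the entropy rate. -/
theorem eventually_prefix_le (hp0 : 0 < p) (hp : p < 1 / 2) {m : ℕ → ℕ} (hm : ∀ n, m n ≤ n)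
    (hhide : ∀ n, (c n).HidesPrefix (bernoulli p) (m n))
    (hc : Tendsto (fun n => (c n).successProb (bernoulli p)) atTop (𝓝 1)) {δ : ℝ} (hδ : 0 < δ) :
    ∀ᶠ n : ℕ in atTop, m n * Real.binEntropy p ≤ n * (R₀ * Real.log 2 + δ) := by
  have hlam := logRatio_pos hp0 hp
  -- With deviation `d * n` typicality costs δn/2 in the exponent; the other δn/2 absorbs log 2. The
  -- threshold 4/d² makes the Chebyshev error at most 1/4, leaving 3/4 - 1/4 = 1/2.
  set d := δ / (2 * logRatio p) with hd
  have hd0 : 0 < d := by positivity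
  filter_upwards [eventually_one_le_numValues hc,
    hc.eventually (lt_mem_nhds (show (3 / 4 : ℝ) < 1 by norm_num)), eventually_ge_atTop 1,
    tendsto_natCast_atTop_atTop.eventually_ge_atTop (4 / d ^ 2),
    tendsto_natCast_atTop_atTop.eventually_ge_atTop (2 / δ * Real.log 2)]
    with n hK hs hn h1 h2
  have hn' : (0 : ℝ) < n := by exact_mod_cast hn
  have hle := (hhide n).successProb_le hp0 hp hK (hm n) (mul_pos hd0 hn')
  have h3 : (m n : ℝ) / (d * n) ^ 2 ≤ 1 / 4 := by
    rw [div_le_iff₀ (by positivity)]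
    have h4 : 4 ≤ n * d ^ 2 := by rwa [div_le_iff₀ (by positivity)] at h1
    have h5 : (m n : ℝ) ≤ n := by exact_mod_cast hm n
    nlinarith
  have h4 : (1 / 2 : ℝ) ≤ Real.exp (n * (R₀ * Real.log 2)) *
      Real.exp (-(m n * Real.binEntropy p) + d * n * logRatio p) := by
    refine le_trans (by linarith) (mul_le_mul_of_nonneg_right (numValues_le_exp n R₀)
      (Real.exp_pos _).le)
  rw [← Real.exp_add, ← Real.log_le_iff_le_exp (by norm_num), one_div, Real.log_inv] at h4
  have h5 : Real.log 2 ≤ δ / 2 * n := by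
    rw [← div_le_iff₀' (by positivity)]
    refine le_trans (le_of_eq ?_) h2
    field_simp
  have h6 : d * n * logRatio p = δ / 2 * n := by
    rw [hd]
    field_simp
  rw [h6] at h4
  linarith

theorem le_of_perfectlySecret (hp0 : 0 < p) (hp : p < 1 / 2)
    (hsec : ∀ n, (c n).PerfectlySecret (bernoulli p))
    (hc : Tendsto (fun n => (c n).successProb (bernoulli p)) atTop (𝓝 1)) :
    binaryEntropy p ≤ R₀ := by
  have hlog2 : 0 < Real.log 2 := Real.log_pos (by norm_num)
  rw [binaryEntropy, div_le_iff₀ hlog2]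
  refine le_of_forall_pos_le_add fun δ hδ => ?_
  obtain ⟨n, h, hn⟩ := ((eventually_prefix_le hp0 hp (fun n => le_refl n) hsec hc hδ).and
    (eventually_ge_atTop 1)).exists
  exact le_of_mul_le_mul_left h (by exact_mod_cast hn)

theorem CanForceNaively.le {k : CodeClass} {D : ℝ} (hp0 : 0 < p) (hp : p < 1 / 2)
    (h : CanForceNaively k (bernoulli p) hamming R₀ R D) : D ≤ R₀ / binaryEntropy p * p := by
  obtain ⟨c, m, r, -, hm, hhide, hrev, hc, hD⟩ := h
  have hh := binEntropy_pos' hp0 hp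
  have hlog2 : 0 < Real.log 2 := Real.log_pos (by norm_num)
  refine le_of_forall_pos_le_add fun ε hε => ?_
  -- This slack in the prefix length becomes exactly ε in distortion after division by the entropy
  -- and multiplication by `p`.
  have hδ : 0 < ε * Real.binEntropy p / p := by positivity
  refine ge_of_tendsto (tendsto_one_sub hrev _) ?_
  filter_upwards [eventually_one_le_numValues hc, eventually_ge_atTop 1,
    eventually_prefix_le hp0 hp hm hhide hc hδ] with n hK hn hmn
  refine (hD n hn).trans (((c n).forcedDistortion_le_prefix hn hK hp0 hp (hm n) (r n)).trans ?_)
  gcongr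
  have hn' : (0 : ℝ) < n := by exact_mod_cast hn
  have h1 : (m n : ℝ) / n ≤ (R₀ * Real.log 2 + ε * Real.binEntropy p / p) / Real.binEntropy p := by
    rw [div_le_div_iff₀ hn' hh]
    linarith
  calc (m n : ℝ) / n * p ≤
        (R₀ * Real.log 2 + ε * Real.binEntropy p / p) / Real.binEntropy p * p := by gcongr
    _ = _ := by
      rw [binaryEntropy]
      field_simp

end Converse

/-! ### Codes at given rates -/

/-- The polynomial overhead of the cube cover. It is at most 8n³, the exponential is at least
(εn)⁴/4!, and 192 = 8 · 4!. -/
theorem eventually_mul_le_exp {ε : ℝ} (hε : 0 < ε) :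
    ∀ᶠ n : ℕ in atTop, ((n : ℝ) + 1) * (n * (2 * n + 1) + 1) ≤ Real.exp (ε * n) := by
  filter_upwards [eventually_ge_atTop 1,
    tendsto_natCast_atTop_atTop.eventually_ge_atTop (192 / ε ^ 4)] with n hn h
  have hn' : (1 : ℝ) ≤ n := by exact_mod_cast hn
  rw [div_le_iff₀ (by positivity)] at h
  refine le_trans ?_ (Real.pow_div_factorial_le_exp (ε * n) (by positivity) 4)
  have h1 : ((n : ℝ) + 1) * (n * (2 * n + 1) + 1) ≤ (2 * n) * (4 * n ^ 2) := by
    gcongr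
    · linarith
    · nlinarith
  have h2 : (192 : ℝ) * n ^ 3 ≤ n * ε ^ 4 * n ^ 3 := by gcongr
  refine h1.trans ?_
  rw [le_div_iff₀ (by positivity)]
  norm_num [Nat.factorial]
  nlinarith

/-- Naive codes: hide a prefix of relative length `β`, reveal the rest. -/
theorem eventually_exists_prefix_code {p R₀ R β : ℝ} (hp0 : 0 < p) (hp : p < 1 / 2)
    (hβ0 : 0 ≤ β) (hβ1 : β ≤ 1) (hR₀ : β * Real.binEntropy p < R₀ * Real.log 2)
    (hR : R₀ * Real.log 2 + (1 - β) * Real.binEntropy p < R * Real.log 2) :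
    ∃ V : ℝ, ∀ᶠ n : ℕ in atTop,
      ∃ (c : Code Bool n (numValues n R₀) (numValues n R)) (r : Fin (numValues n R) → Fin n → Bool),
        c.IsDeterministic ∧ c.HidesPrefix (bernoulli p) ⌊β * n⌋₊ ∧
        1 - V / n ≤ c.revealProb (bernoulli p) ⌊β * n⌋₊ r ∧
        1 - V / n ≤ c.successProb (bernoulli p) := by
  have hlam := logRatio_pos hp0 hp
  have hh := binEntropy_pos' hp0 hp
  have hlog2 : 0 < Real.log 2 := Real.log_pos (by norm_num)
  set h := Real.binEntropy p
  obtain ⟨ε, hε0, hε1, hε2⟩ : ∃ ε : ℝ, 0 < ε ∧ β * h + ε ≤ R₀ * Real.log 2 ∧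
      R₀ * Real.log 2 + (1 - β) * h + 2 * ε ≤ R * Real.log 2 := by
    refine ⟨min (R₀ * Real.log 2 - β * h)
      ((R * Real.log 2 - (R₀ * Real.log 2 + (1 - β) * h)) / 2),
      lt_min (by linarith) (by linarith), ?_, ?_⟩
    · linarith [min_le_left (R₀ * Real.log 2 - β * h)
        ((R * Real.log 2 - (R₀ * Real.log 2 + (1 - β) * h)) / 2)]
    · linarith [min_le_right (R₀ * Real.log 2 - β * h)
        ((R * Real.log 2 - (R₀ * Real.log 2 + (1 - β) * h)) / 2)]
  set δ := ε / logRatio p with hδ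
  have hδ0 : 0 < δ := by positivity
  have hδε : ∀ n : ℕ, δ * n * logRatio p = ε * n := fun n => by rw [hδ]; field_simp
  refine ⟨2 / δ ^ 2, ?_⟩
  -- Rounding the prefix length down lengthens the suffix by less than one symbol, costing at most h
  -- ≤ εn.
  filter_upwards [eventually_ge_atTop 1,
    tendsto_natCast_atTop_atTop.eventually_ge_atTop (h / ε)] with n hn hnh
  have hn' : (0 : ℝ) < n := by exact_mod_cast hn
  rw [div_le_iff₀ hε0] at hnh
  set m := ⌊β * n⌋₊ with hm
  have hmle : (m : ℝ) ≤ β * n := Nat.floor_le (by positivity)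
  have hmge : β * n < m + 1 := Nat.lt_floor_add_one _
  have hmn : m ≤ n := by
    have : (m : ℝ) ≤ n := hmle.trans (by nlinarith)
    exact_mod_cast this
  have hc1 : Fintype.card {j : Fin n // j.val < m} = m := by
    rw [Fintype.card_subtype, Fin.card_filter_val_lt, min_eq_right hmn]
  have hc2 : Fintype.card {j : Fin n // ¬ j.val < m} = n - m := by
    rw [Fintype.card_subtype_compl, hc1, Fintype.card_fin]
  have hc2' : ((Fintype.card {j : Fin n // ¬ j.val < m} : ℕ) : ℝ) = n - m := by
    rw [hc2, Nat.cast_sub hmn]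
  set T₁ := typical {j : Fin n // j.val < m} p (δ * n)
  set T₂ := typical {j : Fin n // ¬ j.val < m} p (δ * n)
  have hT₁ : (T₁.card : ℝ) ≤ Real.exp (n * (R₀ * Real.log 2)) := by
    refine (card_le_exp_of_subset_typical hp0 hp subset_rfl).trans (Real.exp_le_exp.2 ?_)
    rw [hc1, hδε]
    nlinarith
  have hT₂ : (T₂.card : ℝ) ≤ Real.exp ((n - m) * h + ε * n) := by
    have := card_le_exp_of_subset_typical hp0 hp (s := T₂) subset_rfl
    rwa [hc2', hδε] at this
  have hpos : (0 : ℝ) ≤ (n - m) * h + ε * n := by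
    have : (m : ℝ) ≤ n := by exact_mod_cast hmn
    have := mul_nonneg (sub_nonneg.2 this) hh.le
    positivity
  have hN : ((max 1 T₂.card : ℕ) : ℝ) ≤ Real.exp ((n - m) * h + ε * n) := by
    rw [Nat.cast_max]
    exact max_le (by simpa using hpos) hT₂
  have hM : max 1 T₂.card * numValues n R₀ ≤ numValues n R := by
    refine le_numValues ?_
    rw [Nat.cast_mul]
    calc _ ≤ Real.exp ((n - m) * h + ε * n) * Real.exp (n * (R₀ * Real.log 2)) := by
          gcongr
          exact numValues_le_exp n R₀
      _ ≤ _ := by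
          rw [← Real.exp_add, Real.exp_le_exp]
          nlinarith
  have hR₀' : 0 ≤ R₀ := by
    have : 0 ≤ R₀ * Real.log 2 := (mul_nonneg hβ0 hh.le).trans hR₀.le
    exact nonneg_of_mul_nonneg_left this hlog2
  obtain ⟨c, r, hc, hcr⟩ := Code.exists_prefix_code (one_le_numValues n hR₀') (le_max_left 1 _) hM
    T₁ T₂ (le_numValues hT₁) (le_max_right 1 _)
  obtain ⟨h1, h2, h3⟩ := hcr p hp0 hp
  have hb : ∀ k : ℕ, (k : ℝ) ≤ n → (k : ℝ) / (δ * n) ^ 2 ≤ 1 / δ ^ 2 / n := by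
    intro k hk
    rw [div_div, div_le_div_iff₀ (by positivity) (by positivity)]
    have : 0 ≤ δ ^ 2 * n := by positivity
    nlinarith
  have ht1 : 1 - 1 / δ ^ 2 / n ≤ ∑ u ∈ T₁, seqProb p u := by
    refine le_trans ?_ (le_sum_typical hp0 hp (by positivity))
    rw [hc1]
    linarith [hb m (by exact_mod_cast hmn)]
  have ht2 : 1 - 1 / δ ^ 2 / n ≤ ∑ v ∈ T₂, seqProb p v := by
    refine le_trans ?_ (le_sum_typical hp0 hp (by positivity))
    linarith [hb (Fintype.card {j : Fin n // ¬ j.val < m}) (by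
      rw [hc2]; exact_mod_cast Nat.sub_le n m)]
  have hV : 2 / δ ^ 2 / n = 2 * (1 / δ ^ 2 / n) := by ring
  have hV0 : 0 ≤ 1 / δ ^ 2 / (n : ℝ) := by positivity
  have hle1 : ∑ u ∈ T₁, seqProb p u ≤ 1 := by
    rw [← sum_seqProb (ι := {j : Fin n // j.val < m}) p]
    exact Finset.sum_le_univ_sum_of_nonneg fun u => (seqProb_pos hp0 hp u).le
  have hle2 : ∑ v ∈ T₂, seqProb p v ≤ 1 := by
    rw [← sum_seqProb (ι := {j : Fin n // ¬ j.val < m}) p]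
    exact Finset.sum_le_univ_sum_of_nonneg fun u => (seqProb_pos hp0 hp u).le
  exact ⟨c, r, hc, h1, by linarith, by nlinarith⟩

/-- Cube codes force distortion up to half the key rate. -/
theorem eventually_exists_cube_code {p R₀ R a D : ℝ} (hp0 : 0 < p) (hp : p < 1 / 2)
    (ha0 : 0 < a) (hap : a < p) (hR₀ : 2 * a ≤ R₀) (hR : Real.binEntropy p < R * Real.log 2)
    (hD : D < a) :
    ∃ V : ℝ, ∀ᶠ n : ℕ in atTop,
      ∃ c : Code Bool n (numValues n R₀) (numValues n R), c.IsDeterministic ∧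
        1 - V / n ≤ c.successProb (bernoulli p) ∧
        D ≤ c.forcedDistortion (bernoulli p) hamming := by
  have hlam := logRatio_pos hp0 hp
  have hh := binEntropy_pos' hp0 hp
  have hlog2 : 0 < Real.log 2 := Real.log_pos (by norm_num)
  have h2p : 2 * p * Real.log 2 < Real.binEntropy p := by
    have := two_mul_lt_binaryEntropy hp0 hp
    rwa [binaryEntropy, lt_div_iff₀ hlog2] at this
  set h := Real.binEntropy p with hhdef
  obtain ⟨η, hη0, hη1, hη2⟩ : ∃ η : ℝ, 0 < η ∧ η ≤ 1 / 2 ∧ D < (1 - 2 * η) * a := by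
    refine ⟨min (1 / 4) ((a - D) / (4 * a)), lt_min (by norm_num)
      (div_pos (by linarith) (by positivity)), (min_le_left _ _).trans (by norm_num), ?_⟩
    have h1 := min_le_right (1 / 4) ((a - D) / (4 * a))
    rw [le_div_iff₀ (by positivity)] at h1
    nlinarith
  -- The first bound makes every typical weight at least `l`. The second fits the cover into the
  -- message rate. The third keeps the losses, two from the cover and one from the likelihood,
  -- within half of the Chernoff exponent 4η²an.
  obtain ⟨δ, hδ0, hδ1, hδ2, hδ3⟩ : ∃ δ : ℝ, 0 < δ ∧ δ ≤ p - a ∧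
      h + 2 * (δ * logRatio p) ≤ R * Real.log 2 ∧ 3 * (δ * logRatio p) ≤ 2 * η ^ 2 * a := by
    have e1 : 0 < (R * Real.log 2 - h) / (2 * logRatio p) := div_pos (by linarith) (by positivity)
    have e2 : 0 < 2 * η ^ 2 * a / (3 * logRatio p) := by positivity
    refine ⟨min (p - a) (min ((R * Real.log 2 - h) / (2 * logRatio p))
      (2 * η ^ 2 * a / (3 * logRatio p))), lt_min (by linarith) (lt_min e1 e2),
      min_le_left _ _, ?_, ?_⟩
    · have := (min_le_right (p - a) _).trans (min_le_left ((R * Real.log 2 - h) / (2 * logRatio p))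
        (2 * η ^ 2 * a / (3 * logRatio p)))
      rw [le_div_iff₀ (by positivity)] at this
      linarith
    · have := (min_le_right (p - a) _).trans (min_le_right
        ((R * Real.log 2 - h) / (2 * logRatio p)) (2 * η ^ 2 * a / (3 * logRatio p)))
      rw [le_div_iff₀ (by positivity)] at this
      linarith
  have hε0 : 0 < δ * logRatio p := by positivity
  set ε := δ * logRatio p with hε
  have hlim : Tendsto (fun n : ℕ => (1 - 2 * η) * (a - 1 / n - (1 / δ ^ 2 / n +
      2 * Real.exp (4 * η ^ 2) * Real.exp (-(2 * η ^ 2 * a * n))))) atTop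
      (𝓝 ((1 - 2 * η) * a)) := by
    have l1 : Tendsto (fun n : ℕ => (1 : ℝ) / n) atTop (𝓝 0) := tendsto_one_div_atTop_nhds_zero_nat
    have l2 : Tendsto (fun n : ℕ => 1 / δ ^ 2 / (n : ℝ)) atTop (𝓝 0) :=
      tendsto_const_div_atTop_nhds_zero_nat _
    have l3 : Tendsto (fun n : ℕ => Real.exp (-(2 * η ^ 2 * a * n))) atTop (𝓝 0) := by
      refine Real.tendsto_exp_neg_atTop_nhds_zero.comp ?_
      exact tendsto_natCast_atTop_atTop.const_mul_atTop (by positivity)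
    have := ((l1.const_sub a).sub (l2.add (l3.const_mul (2 * Real.exp (4 * η ^ 2))))).const_mul
      (1 - 2 * η)
    simpa using this
  refine ⟨1 / δ ^ 2, ?_⟩
  filter_upwards [eventually_ge_atTop 1, eventually_mul_le_exp hε0,
    tendsto_natCast_atTop_atTop.eventually_gt_atTop (1 / δ ^ 2),
    hlim.eventually (lt_mem_nhds hη2)] with n hn hpoly hnδ hDn
  have hn' : (0 : ℝ) < n := by exact_mod_cast hn
  set l := ⌊a * n⌋₊ with hl
  have hlle : (l : ℝ) ≤ a * n := Nat.floor_le (by positivity)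
  have hlge : a * n < l + 1 := Nat.lt_floor_add_one _
  have hln : (l : ℝ) ≤ n := hlle.trans (mul_le_of_le_one_left hn'.le (by linarith))
  have h4 : (4 : ℝ) ^ l = Real.exp (l * (2 * Real.log 2)) := by
    rw [Real.exp_nat_mul, show 2 * Real.log 2 = Real.log 2 + Real.log 2 by ring, Real.exp_add,
      Real.exp_log (by norm_num)]
    norm_num
  have hlw : ∀ w : ℕ, w ≤ Fintype.card (Fin n) →
      |(w : ℝ) - Fintype.card (Fin n) * p| ≤ δ * n → l ≤ w ∧ l ≤ Fintype.card (Fin n) - w := by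
    intro w hw hwp
    rw [Fintype.card_fin] at hw hwp ⊢
    rw [abs_le] at hwp
    have e1 := mul_le_mul_of_nonneg_right hδ1 hn'.le
    constructor
    · have : (l : ℝ) ≤ w := by linarith
      exact_mod_cast this
    · have : (l : ℝ) ≤ (n - w : ℕ) := by
        have e2 := mul_nonneg hn'.le (by linarith : 0 ≤ 1 - 2 * p)
        rw [Nat.cast_sub hw]
        linarith
      exact_mod_cast this
  obtain ⟨𝒞, hcard, hdim, hcov⟩ := exists_cover_typical (ι := Fin n) hp0 hp hlw
  have hcard' : (𝒞.card : ℝ) * 4 ^ l ≤ Real.exp (n * h + 2 * (ε * n)) := by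
    rw [Fintype.card_fin, ← hhdef, show δ * n * logRatio p = ε * n by rw [hε]; ring] at hcard
    refine hcard.trans ?_
    -- This handles the additive term of the cover size; it uses a < p and 2p < H(p).
    have e1 : (4 : ℝ) ^ l ≤ Real.exp (n * h + ε * n) := by
      rw [h4, Real.exp_le_exp]
      have : l * (2 * Real.log 2) ≤ n * (2 * p * Real.log 2) := by
        have e2 : (l : ℝ) ≤ p * n := hlle.trans (by gcongr)
        have e3 := mul_le_mul_of_nonneg_right e2 (by positivity : 0 ≤ 2 * Real.log 2)
        linarith
      have := mul_le_mul_of_nonneg_left h2p.le hn'.le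
      have : 0 ≤ ε * n := by positivity
      linarith
    calc _ ≤ ((n : ℝ) + 1) * (n * (2 * n + 1) * Real.exp (n * h + ε * n) +
          Real.exp (n * h + ε * n)) := by gcongr
      _ = (((n : ℝ) + 1) * (n * (2 * n + 1) + 1)) * Real.exp (n * h + ε * n) := by ring
      _ ≤ Real.exp (ε * n) * Real.exp (n * h + ε * n) := by gcongr
      _ = _ := by
        rw [← Real.exp_add]
        ring_nf
  have hT : 1 - 1 / δ ^ 2 / n ≤ ∑ x ∈ typical (Fin n) p (δ * n), seqProb p x := by
    refine le_trans (le_of_eq ?_) (le_sum_typical hp0 hp (by positivity))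
    rw [Fintype.card_fin]
    field_simp
  have hne : 1 ≤ 𝒞.card := by
    have h0 : (0 : ℝ) < ∑ x ∈ typical (Fin n) p (δ * n), seqProb p x := by
      refine lt_of_lt_of_le ?_ hT
      rw [sub_pos, div_lt_one hn']
      exact hnδ
    obtain ⟨x, hx, -⟩ := Finset.exists_ne_zero_of_sum_ne_zero h0.ne'
    obtain ⟨u, hu, -⟩ := hcov x hx
    exact Finset.card_pos.2 ⟨u, hu⟩
  have hK : 4 ^ l ≤ numValues n R₀ := by
    refine le_numValues ?_
    push_cast
    rw [h4, Real.exp_le_exp]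
    have e0 := mul_le_mul_of_nonneg_right hR₀ hn'.le
    have e1 : (l : ℝ) * 2 ≤ n * R₀ := by linarith
    have e2 := mul_le_mul_of_nonneg_right e1 hlog2.le
    linarith
  have hM : 𝒞.card * 4 ^ l ≤ numValues n R := by
    refine le_numValues ?_
    push_cast
    refine hcard'.trans (Real.exp_le_exp.2 ?_)
    have e1 := mul_le_mul_of_nonneg_left hδ2 hn'.le
    linarith
  obtain ⟨c, hc, hs, hf⟩ := Code.exists_cube_code hp0 hp 𝒞 hdim hcov hne hK hM
  refine ⟨c, hc, hT.trans hs, le_trans hDn.le (le_trans ?_ (hf η hη0.le hη1))⟩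
  set P := ∑ x ∈ typical (Fin n) p (δ * n), seqProb p x
  -- The factor exp(4η²) pays for rounding, as l > an - 1.
  have hu : 2 * (𝒞.card * 4 ^ l) * Real.exp (-(4 * η ^ 2 * l)) *
      Real.exp (-(n * Real.binEntropy p) + δ * n * logRatio p) ≤
      2 * Real.exp (4 * η ^ 2) * Real.exp (-(2 * η ^ 2 * a * n)) := by
    calc _ ≤ 2 * Real.exp (n * h + 2 * (ε * n)) * Real.exp (-(4 * η ^ 2 * l)) *
          Real.exp (-(n * h) + δ * n * logRatio p) := by gcongr
      _ = 2 * Real.exp (3 * ε * n - 4 * η ^ 2 * l) := by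
          rw [mul_assoc, mul_assoc, ← Real.exp_add, ← Real.exp_add, hε]
          ring_nf
      _ ≤ 2 * Real.exp (4 * η ^ 2 + -(2 * η ^ 2 * a * n)) := by
          gcongr
          have e1 := mul_le_mul_of_nonneg_right hδ3 hn'.le
          have e2 := mul_le_mul_of_nonneg_left hlge.le (by positivity : 0 ≤ 4 * η ^ 2)
          linarith
      _ = _ := by rw [Real.exp_add, ← mul_assoc]
  have hq : (n : ℝ)⁻¹ * l ≤ 1 := by
    rw [inv_mul_le_iff₀ hn']
    linarith
  have hq' : a - 1 / n ≤ (n : ℝ)⁻¹ * l := by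
    rw [le_inv_mul_iff₀ hn', mul_sub, mul_one_div_cancel hn'.ne']
    linarith
  set u := 1 / δ ^ 2 / n + 2 * Real.exp (4 * η ^ 2) * Real.exp (-(2 * η ^ 2 * a * n)) with hudef
  have hu0 : 0 ≤ u := by positivity
  calc (1 - 2 * η) * (a - 1 / n - u) ≤ (1 - 2 * η) * ((n : ℝ)⁻¹ * l * (1 - u)) := by
        refine mul_le_mul_of_nonneg_left ?_ (by linarith)
        have e1 := mul_le_mul_of_nonneg_right hq hu0
        linarith
    _ = (n : ℝ)⁻¹ * ((1 - 2 * η) * l * (1 - u)) := by ring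
    _ ≤ _ := by
        refine mul_le_mul_of_nonneg_left (mul_le_mul_of_nonneg_left ?_
          (mul_nonneg (by linarith) (Nat.cast_nonneg _))) (by positivity)
        linarith

theorem tendsto_one_of_eventually_le {f : ℕ → ℝ} {V : ℝ} (h1 : ∀ n, f n ≤ 1)
    (h2 : ∀ᶠ n : ℕ in atTop, 1 - V / n ≤ f n) : Tendsto f atTop (𝓝 1) := by
  refine tendsto_of_tendsto_of_tendsto_of_le_of_le' (g := fun n : ℕ => 1 - V / n) ?_
    tendsto_const_nhds h2 (Eventually.of_forall h1)
  simpa using (tendsto_const_div_atTop_nhds_zero_nat V).const_sub 1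

theorem canForce_of_lt {p R₀ R a D : ℝ} (k : CodeClass) (hp0 : 0 < p) (hp : p < 1 / 2)
    (ha0 : 0 < a) (hap : a < p) (hR₀ : 2 * a ≤ R₀) (hR : Real.binEntropy p < R * Real.log 2)
    (hD : D < a) : CanForce k (bernoulli p) hamming R₀ R D := by
  obtain ⟨V, hV⟩ := eventually_exists_cube_code hp0 hp ha0 hap hR₀ hR hD
  obtain ⟨n₀, hn₀⟩ := eventually_atTop.1 hV
  have hR₀' : 0 ≤ R₀ := by linarith
  have hR' : 0 ≤ R := nonneg_of_mul_nonneg_left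
    ((binEntropy_pos' hp0 hp).trans hR).le (Real.log_pos (by norm_num))
  have key : ∀ n : ℕ, ∃ c : Code Bool n (numValues n R₀) (numValues n R), c.IsDeterministic ∧
      (n₀ ≤ n → 1 - V / n ≤ c.successProb (bernoulli p)) ∧
      (1 ≤ n → D ≤ c.forcedDistortion (bernoulli p) hamming) := by
    intro n
    by_cases hn : n₀ ≤ n
    · obtain ⟨c, h1, h2, h3⟩ := hn₀ n hn
      exact ⟨c, h1, fun _ => h2, fun _ => h3⟩
    -- Distortion is demanded at every length but success only in the limit, so short blocks may
    -- send nothing, which forces `p`.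
    · obtain ⟨c, h1, h2⟩ := Code.exists_constant_code n (one_le_numValues n hR₀')
        (one_le_numValues n hR')
      refine ⟨c, h1, fun h => absurd h hn, fun hn1 => ?_⟩
      rw [Code.PerfectlySecret.forcedDistortion_eq hp0 hp (one_le_numValues n hR₀') (h2 p n) hn1]
      linarith
  choose c h1 h2 h3 using key
  exact ⟨c, fun n => (h1 n).inClass k, tendsto_one_of_eventually_le
    (fun n => (c n).successProb_le_one (one_le_numValues n hR₀') hp0 hp)
    (eventually_atTop.2 ⟨n₀, h2⟩), h3⟩

theorem exists_prefix_codes {p R₀ R β : ℝ} (k : CodeClass) (hp0 : 0 < p) (hp : p < 1 / 2)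
    (hβ0 : 0 ≤ β) (hβ1 : β ≤ 1) (hR₀ : β * Real.binEntropy p < R₀ * Real.log 2)
    (hR : R₀ * Real.log 2 + (1 - β) * Real.binEntropy p < R * Real.log 2) (n₁ : ℕ) :
    ∃ (c : ∀ n : ℕ, Code Bool n (numValues n R₀) (numValues n R)) (m : ℕ → ℕ)
      (r : ∀ n : ℕ, Fin (numValues n R) → Fin n → Bool),
      (∀ n, (c n).InClass k) ∧ (∀ n, m n ≤ n) ∧
      (∀ n, (c n).HidesPrefix (bernoulli p) (m n)) ∧
      Tendsto (fun n => (c n).revealProb (bernoulli p) (m n) (r n)) atTop (𝓝 1) ∧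
      Tendsto (fun n => (c n).successProb (bernoulli p)) atTop (𝓝 1) ∧
      ∀ n, m n = n ∨ (n₁ ≤ n ∧ m n = ⌊β * n⌋₊) := by
  have hlog2 : 0 < Real.log 2 := Real.log_pos (by norm_num)
  have hh := binEntropy_pos' hp0 hp
  obtain ⟨V, hV⟩ := eventually_exists_prefix_code hp0 hp hβ0 hβ1 hR₀ hR
  obtain ⟨n₀, hn₀⟩ := eventually_atTop.1 (hV.and (eventually_ge_atTop n₁))
  have hR₀' : 0 ≤ R₀ :=
    nonneg_of_mul_nonneg_left ((mul_nonneg hβ0 hh.le).trans hR₀.le) hlog2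
  have hR' : 0 ≤ R := by
    refine nonneg_of_mul_nonneg_left (le_trans ?_ hR.le) hlog2
    have := mul_nonneg (sub_nonneg.2 hβ1) hh.le
    positivity
  have key : ∀ n : ℕ, ∃ (c : Code Bool n (numValues n R₀) (numValues n R)) (m : ℕ)
      (r : Fin (numValues n R) → Fin n → Bool), c.InClass k ∧ m ≤ n ∧
      c.HidesPrefix (bernoulli p) m ∧
      (n₀ ≤ n → 1 - V / n ≤ c.revealProb (bernoulli p) m r) ∧
      (n₀ ≤ n → 1 - V / n ≤ c.successProb (bernoulli p)) ∧
      (m = n ∨ (n₁ ≤ n ∧ m = ⌊β * n⌋₊)) := by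
    intro n
    by_cases hn : n₀ ≤ n
    · obtain ⟨⟨c, r, h1, h2, h3, h4⟩, h5⟩ := hn₀ n hn
      refine ⟨c, _, r, h1.inClass k, ?_, h2, fun _ => h3, fun _ => h4, Or.inr ⟨h5, rfl⟩⟩
      exact Nat.floor_le_of_le (mul_le_of_le_one_left (Nat.cast_nonneg n) hβ1)
    · obtain ⟨c, h1, h2⟩ := Code.exists_constant_code n (one_le_numValues n hR₀')
        (one_le_numValues n hR')
      exact ⟨c, n, fun _ _ => false, h1.inClass k, le_rfl, h2 p n, fun h => absurd h hn,
        fun h => absurd h hn, Or.inl rfl⟩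
  choose c m r h1 h2 h3 h4 h5 h6 using key
  exact ⟨c, m, r, h1, h2, h3, tendsto_one_of_eventually_le
    (fun n => (c n).revealProb_le_one (one_le_numValues n hR₀') hp0 hp _ _)
    (eventually_atTop.2 ⟨n₀, h4⟩), tendsto_one_of_eventually_le
    (fun n => (c n).successProb_le_one (one_le_numValues n hR₀') hp0 hp)
    (eventually_atTop.2 ⟨n₀, h5⟩), h6⟩

/-! ### Extreme points of the closed regions -/

theorem binEntropy_le_mul_log {p R : ℝ} (hR : binaryEntropy p ≤ R) :
    Real.binEntropy p ≤ R * Real.log 2 := by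
  rw [← binaryEntropy_mul_log]
  exact mul_le_mul_of_nonneg_right hR (Real.log_nonneg (by norm_num))

/-- The constructions need strict inequalities. The message rate gets 2ε because a padded prefix
index uses up the extra key rate ε. -/
theorem tendsto_perturbed_triple (R₀ R D : ℝ) :
    Tendsto (fun ε : ℝ => (R₀ + ε, R + 2 * ε, D - ε)) (𝓝[>] 0) (𝓝 (R₀, R, D)) := by
  have h : Continuous fun ε : ℝ => (R₀ + ε, R + 2 * ε, D - ε) := by fun_prop
  have := (h.tendsto 0).mono_left (nhdsWithin_le_nhds (s := Set.Ioi 0))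
  simpa using this

theorem isGreatest_secrecyRegion {p R₀ R : ℝ} (k : CodeClass) (hp0 : 0 < p) (hp : p < 1 / 2)
    (hR₀ : 0 ≤ R₀) (hR : binaryEntropy p ≤ R) :
    IsGreatest {D : ℝ | (R₀, R, D) ∈ secrecyRegion k (bernoulli p) hamming} (min (R₀ / 2) p) := by
  have hlog2 : 0 < Real.log 2 := Real.log_pos (by norm_num)
  have hR' := binEntropy_le_mul_log hR
  constructor
  · refine mem_closure_of_tendsto (tendsto_perturbed_triple _ _ _) ?_
    filter_upwards [self_mem_nhdsWithin] with ε hε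
    rw [Set.mem_Ioi] at hε
    have e1 := min_le_left (p / 2) (ε / 2)
    have e2 := min_le_right (p / 2) (ε / 2)
    have e3 : 0 < min (p / 2) (ε / 2) := lt_min (by linarith) (by linarith)
    have e4 := min_le_left (R₀ / 2) p
    have e5 := min_le_right (R₀ / 2) p
    -- The value of `a` must stay below `p`, at most half the key rate, and above the target lowered
    -- by ε.
    refine canForce_of_lt (a := min ((R₀ + ε) / 2) (p - min (p / 2) (ε / 2))) k hp0 hp
      (lt_min (by linarith) (by linarith)) ((min_le_right _ _).trans_lt (by linarith)) ?_ ?_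
      (lt_min ?_ ?_)
    · have := min_le_left ((R₀ + ε) / 2) (p - min (p / 2) (ε / 2))
      linarith
    · have := mul_pos hε hlog2
      linarith
    · linarith
    · linarith
  · intro D hD
    -- The converse inequality is a closed condition, so it passes to the closure.
    have hsub : secrecyRegion k (bernoulli p) hamming ⊆
        {t : ℝ × ℝ × ℝ | t.2.2 ≤ min (t.1 / 2) p} :=
      closure_minimal (fun t ht => CanForce.le hp0 hp ht)
        (isClosed_le (by fun_prop) (by fun_prop))
    exact hsub hD

theorem isGreatest_naiveRegion {p R₀ R : ℝ} (k : CodeClass) (hp0 : 0 < p) (hp : p < 1 / 2)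
    (hR₀ : 0 ≤ R₀) (hR₀' : R₀ ≤ binaryEntropy p) (hR : binaryEntropy p ≤ R) :
    IsGreatest {D : ℝ | (R₀, R, D) ∈ naiveRegion k (bernoulli p) hamming}
      (R₀ / binaryEntropy p * p) := by
  have hlog2 : 0 < Real.log 2 := Real.log_pos (by norm_num)
  have hH := binaryEntropy_pos hp0 hp
  have hR' := binEntropy_le_mul_log hR
  constructor
  · refine mem_closure_of_tendsto (tendsto_perturbed_triple _ _ _) ?_
    filter_upwards [self_mem_nhdsWithin] with ε hε
    rw [Set.mem_Ioi] at hε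
    have hεl := mul_pos hε hlog2
    have hβ : R₀ / binaryEntropy p * Real.binEntropy p = R₀ * Real.log 2 := by
      rw [← binaryEntropy_mul_log, ← mul_assoc, div_mul_cancel₀ _ hH.ne']
    have hβ0 : 0 ≤ R₀ / binaryEntropy p := by positivity
    have hβ1 : R₀ / binaryEntropy p ≤ 1 := (div_le_one hH).2 hR₀'
    -- The hidden fraction is R₀/H(p). From length p/ε on, rounding it down loses at most ε in
    -- distortion.
    have hcodes := exists_prefix_codes (R₀ := R₀ + ε) (R := R + 2 * ε) k hp0 hp hβ0 hβ1
      (by rw [hβ]; linarith) (by rw [sub_mul, hβ]; linarith) (⌈p / ε⌉₊)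
    obtain ⟨c, m, r, h1, h2, h3, h4, h5, h6⟩ := hcodes
    refine ⟨c, m, r, h1, h2, h3, h4, h5, fun n hn => ?_⟩
    refine le_trans ?_ ((h3 n).le_forcedDistortion hp0 hp
      (one_le_numValues n (by linarith)) (h2 n))
    have hn' : (0 : ℝ) < n := by exact_mod_cast hn
    rcases h6 n with h | ⟨h, h'⟩
    · rw [h, div_self hn'.ne']
      have := mul_le_mul_of_nonneg_right hβ1 hp0.le
      linarith
    · have e1 := Nat.lt_floor_add_one (R₀ / binaryEntropy p * n)
      rw [← h'] at e1
      have e2 : p ≤ n * ε := by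
        rw [← div_le_iff₀ hε]
        exact (Nat.le_ceil _).trans (by exact_mod_cast h)
      rw [div_mul_eq_mul_div (m n : ℝ), le_div_iff₀ hn']
      have e3 := mul_lt_mul_of_pos_right e1 hp0
      linarith
  · intro D hD
    have hsub : naiveRegion k (bernoulli p) hamming ⊆
        {t : ℝ × ℝ × ℝ | t.2.2 ≤ t.1 / binaryEntropy p * p} :=
      closure_minimal (fun t ht => CanForceNaively.le hp0 hp ht)
        (isClosed_le (by fun_prop) (by fun_prop))
    exact hsub hD

theorem isLeast_perfectSecrecyRegion {p R : ℝ} (k : CodeClass) (hp0 : 0 < p) (hp : p < 1 / 2)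
    (hR : binaryEntropy p ≤ R) :
    IsLeast {R₀ : ℝ | (R₀, R) ∈ perfectSecrecyRegion k (bernoulli p)} (binaryEntropy p) := by
  have hlog2 : 0 < Real.log 2 := Real.log_pos (by norm_num)
  have hR' := binEntropy_le_mul_log hR
  constructor
  · have hlim : Tendsto (fun ε : ℝ => (binaryEntropy p + ε, R + 2 * ε)) (𝓝[>] 0)
        (𝓝 (binaryEntropy p, R)) := by
      have h : Continuous fun ε : ℝ => (binaryEntropy p + ε, R + 2 * ε) := by fun_prop
      have := (h.tendsto 0).mono_left (nhdsWithin_le_nhds (s := Set.Ioi 0))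
      simpa using this
    refine mem_closure_of_tendsto hlim ?_
    filter_upwards [self_mem_nhdsWithin] with ε hε
    rw [Set.mem_Ioi] at hε
    have hεl := mul_pos hε hlog2
    have hH := binaryEntropy_mul_log p
    -- With β = 1 the prefix is the whole sequence.
    obtain ⟨c, m, r, h1, -, h3, -, h5, h6⟩ := exists_prefix_codes (R₀ := binaryEntropy p + ε)
      (R := R + 2 * ε) k hp0 hp zero_le_one le_rfl (by linarith) (by linarith) 0
    have hm : ∀ n, m n = n := by
      intro n
      rcases h6 n with h | ⟨-, h⟩
      · exact h
      · rw [h, one_mul, Nat.floor_natCast]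
    refine ⟨c, h1, fun n => ?_, h5⟩
    have := h3 n
    rwa [hm] at this
  · intro R₀ h
    have hsub : perfectSecrecyRegion k (bernoulli p) ⊆ {t : ℝ × ℝ | binaryEntropy p ≤ t.1} :=
      closure_minimal (fun t ⟨c, _, h2, h3⟩ => le_of_perfectlySecret hp0 hp h2 h3)
        (isClosed_le continuous_const continuous_fst)
    exact hsub h

end PartialSecrecy

end

theorem mainTheorem3 (p : ℝ) (hp0 : 0 < p) (hp : p < 1 / 2) :
    -- the optimal forced distortion below key rate `2p`
    (∀ (k : PartialSecrecy.CodeClass) (R₀ R : ℝ),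
      0 ≤ R₀ → R₀ < 2 * p → PartialSecrecy.binaryEntropy p ≤ R →
      IsGreatest {D : ℝ | (R₀, R, D) ∈ PartialSecrecy.secrecyRegion k
        (PartialSecrecy.bernoulli p) PartialSecrecy.hamming} (R₀ / 2)) ∧
    -- the full distortion `p` is forced, and is optimal, from key rate `2p < H(p)` on
    (∀ (k : PartialSecrecy.CodeClass) (R₀ R : ℝ),
      2 * p ≤ R₀ → PartialSecrecy.binaryEntropy p ≤ R →
      IsGreatest {D : ℝ | (R₀, R, D) ∈ PartialSecrecy.secrecyRegion k
        (PartialSecrecy.bernoulli p) PartialSecrecy.hamming} p) ∧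
    2 * p < PartialSecrecy.binaryEntropy p ∧
    -- perfect secrecy forces distortion exactly `p`, and requires key rate `H(p)`
    (∀ (n K M : ℕ) (c : PartialSecrecy.Code Bool n K M), 1 ≤ n → 1 ≤ K →
      c.PerfectlySecret (PartialSecrecy.bernoulli p) →
      c.forcedDistortion (PartialSecrecy.bernoulli p) PartialSecrecy.hamming = p) ∧
    (∀ (k : PartialSecrecy.CodeClass) (R : ℝ), PartialSecrecy.binaryEntropy p ≤ R →
      IsLeast {R₀ : ℝ | (R₀, R) ∈ PartialSecrecy.perfectSecrecyRegion k
        (PartialSecrecy.bernoulli p)} (PartialSecrecy.binaryEntropy p)) ∧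
    -- naive prefix hiding is strictly suboptimal
    (∀ (k : PartialSecrecy.CodeClass) (R₀ R : ℝ),
      0 < R₀ → R₀ < PartialSecrecy.binaryEntropy p → PartialSecrecy.binaryEntropy p ≤ R →
      ∃ D D' : ℝ,
        IsGreatest {D : ℝ | (R₀, R, D) ∈ PartialSecrecy.naiveRegion k
          (PartialSecrecy.bernoulli p) PartialSecrecy.hamming} D ∧
        IsGreatest {D : ℝ | (R₀, R, D) ∈ PartialSecrecy.secrecyRegion k
          (PartialSecrecy.bernoulli p) PartialSecrecy.hamming} D' ∧
        D = R₀ / PartialSecrecy.binaryEntropy p * p ∧ D < D') := by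
  refine ⟨fun k R₀ R h0 h1 hR => ?_, fun k R₀ R h1 hR => ?_,
    PartialSecrecy.two_mul_lt_binaryEntropy hp0 hp,
    fun n K M c hn hK h => h.forcedDistortion_eq hp0 hp hK hn,
    fun k R hR => PartialSecrecy.isLeast_perfectSecrecyRegion k hp0 hp hR,
    fun k R₀ R h0 h1 hR => ⟨_, _,
      PartialSecrecy.isGreatest_naiveRegion k hp0 hp h0.le h1.le hR,
      PartialSecrecy.isGreatest_secrecyRegion k hp0 hp h0.le hR, rfl, ?_⟩⟩
  · have h := PartialSecrecy.isGreatest_secrecyRegion k hp0 hp h0 hR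
    rwa [min_eq_left (by linarith)] at h
  · have h := PartialSecrecy.isGreatest_secrecyRegion k hp0 hp (by linarith : 0 ≤ R₀) hR
    rwa [min_eq_right (by linarith)] at h
  · have hH := PartialSecrecy.binaryEntropy_pos hp0 hp
    have h2 := PartialSecrecy.two_mul_lt_binaryEntropy hp0 hp
    -- Below R₀/2 because 2p < H(p), and below p because R₀ < H(p).
    refine lt_min ?_ ?_
    · rw [div_mul_eq_mul_div, div_lt_div_iff₀ hH (by norm_num), mul_assoc]
      exact mul_lt_mul_of_pos_left (by linarith) h0
    · exact mul_lt_of_lt_one_left hp0 ((div_lt_one hH).2 h1)
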